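/- Let $\mathbb B_n=\{z\in\mathbb C^n:|z|<1\}$ be the Euclidean unit ball, $\mathbf b\in\mathbb C^n\setminus\{0\}$, $\beta>1$, and for $z\in\mathbb B_n$ put $S_z=\{t\in\mathbb C: z+t\mathbf b\in\mathbb B_n\}$. Let $Q_{\mathbf b,\beta}(\mathbb B_n)$ be the class of continuous functions $L:\mathbb B_n\to(0,\infty)$ such that $L(z)>\frac{\beta|\mathbf b|}{1-|z|}$ for all $z\in\mathbb B_n$ and, for every $\eta\in[0,\beta]$, $0<\lambda_1(\eta)\le\lambda_2(\eta)<\infty$, where $\lambda_1(\eta)$ and $\lambda_2(\eta)$ are the infimum and the supremum of $\frac{L(z+t\mathbf b)}{L(z+t_0\mathbf b)}$ over all $z\in\mathbb B_n$, $t_0\in S_z$ and $t\in\mathbb C$ with $|t-t_0|\le\frac{\eta}{L(z+t_0\mathbf b)}$ (these points $z+t\mathbf b$ lie in $\mathbb B_n$). Let $F$ be analytic in $\mathbb B_n$, and put $\frac{\partial F}{\partial\mathbf b}=\sum_{j=1}^n b_j\frac{\partial F}{\partial z_j}$, $\frac{\partial^0F}{\partial\mathbf b^0}=F$, $\frac{\partial^kF}{\partial\mathbf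 b^k}=\frac{\partial}{\partial\mathbf b}\frac{\partial^{k-1}F}{\partial\mathbf b^{k-1}}$. The function $F$ is of bounded $L$-index in the direction $\mathbf b$ if there is $m_0\in\mathbb Z_{\ge0}$ such that for all $m\in\mathbb Z_{\ge0}$ and all $z\in\mathbb B_n$ $$\frac{1}{m!\,L^m(z)}\left|\frac{\partial^mF(z)}{\partial\mathbf b^m}\right|\le\max\left\{\frac{1}{k!\,L^k(z)}\left|\frac{\partial^kF(z)}{\partial\mathbf b^k}\right|:0\le k\le m_0\right\}.$$ For $r>0$ and $z^0\in\mathbb B_n$ let $G_r^{\mathbf b}(F,z^0)=\{z^0+t\mathbf b:t\in S_{z^0}\}$ if $F(z^0+t\mathbf b)=0$ for all $t\in S_{z^0}$, and otherwise let $G_r^{\mathbf b}(F,z^0)=\bigcup_a\left\{z^0+t\mathbf b:|t-a|\le\frac{r}{L(z^0+a\mathbf b)}\right\}$, the union being over all zeros $a\in S_{z^0}$ of $t\mapsto F(z^0+t\mathbf b)$ (so it is empty if there are no zeros). Put $G_r^{\mathbf b}(F)=\bigcup_{z^0\in\mathbb B_n}G_r^{\mathbf b}(F,z^0)$. For $\rho>0$,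 $z^0\in\mathbb B_n$ and $t_0\in S_{z^0}$ let $n(\rho,z^0,t_0,1/F)$ be the number, counted with multiplicity, of zeros $a\in S_{z^0}$ of $t\mapsto F(z^0+t\mathbf b)$ with $|a-t_0|\le\rho$. **Theorem.** Let $F$ be analytic in $\mathbb B_n$, let $L\in Q_{\mathbf b,\beta}(\mathbb B_n)$, and suppose $\mathbb B_n\setminus G_\beta^{\mathbf b}(F)\ne\emptyset$. Then $F$ is of bounded $L$-index in the direction $\mathbf b$ if and only if both of the following hold: 1) for every $r\in(0,\beta]$ there exists $P=P(r)>0$ such that for every $z\in\mathbb B_n\setminus G_r^{\mathbf b}(F)$ $$\left|\frac{1}{F(z)}\frac{\partial F(z)}{\partial\mathbf b}\right|\le P\,L(z);$$ 2) for every $r\in(0,\beta]$ there exists $\tilde n(r)\in\mathbb Z_{\ge0}$ such that for every $z^0\in\mathbb B_n$ for which $t\mapsto F(z^0+t\mathbf b)$ is not identically zero on $S_{z^0}$, and for every $t_0\in S_{z^0}$, $$n\left(\frac{r}{L(z^0+t_0\mathbf b)},z^0,t_0,\frac1F\right)\le\tilde n(r).$$ -/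

import Mathlib

open scoped ENNReal

/-- The directional derivative `∂F/∂b = ∑ⱼ (∂F/∂zⱼ) bⱼ`. -/
noncomputable def dirDeriv {n : ℕ} (b : EuclideanSpace ℂ (Fin n))
    (F : EuclideanSpace ℂ (Fin n) → ℂ) : EuclideanSpace ℂ (Fin n) → ℂ :=
  fun z => fderiv ℂ F z b

/-- The iterated directional derivative: `∂⁰F/∂b⁰ = F`, `∂ᵏ⁺¹F/∂bᵏ⁺¹ = ∂/∂b (∂ᵏF/∂bᵏ)`. -/
noncomputable def iterDirDeriv {n : ℕ} (b : EuclideanSpace ℂ (Fin n)) :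
    ℕ → (EuclideanSpace ℂ (Fin n) → ℂ) → EuclideanSpace ℂ (Fin n) → ℂ
  | 0, F => F
  | k + 1, F => dirDeriv b (iterDirDeriv b k F)

/-- The open unit ball of `ℂⁿ` for the Euclidean norm. -/
def unitBall (n : ℕ) : Set (EuclideanSpace ℂ (Fin n)) := Metric.ball 0 1

/-- `S_z = {t ∈ ℂ : z + t b ∈ 𝔹ₙ}`. -/
def sliceDomain {n : ℕ} (b z : EuclideanSpace ℂ (Fin n)) : Set ℂ :=
  {t : ℂ | z + t • b ∈ unitBall n}

/-- `F` (analytic in the unit ball) is of bounded `L`-index in the direction `b`. -/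
def HasBoundedLIndexInDirection {n : ℕ} (b : EuclideanSpace ℂ (Fin n))
    (L : EuclideanSpace ℂ (Fin n) → ℝ) (F : EuclideanSpace ℂ (Fin n) → ℂ) : Prop :=
  ∃ m₀ : ℕ, ∀ m : ℕ, ∀ z ∈ unitBall n,
    ‖iterDirDeriv b m F z‖ / ((m.factorial : ℝ) * L z ^ m) ≤
      (Finset.range (m₀ + 1)).sup' Finset.nonempty_range_add_one
        (fun k => ‖iterDirDeriv b k F z‖ / ((k.factorial : ℝ) * L z ^ k))

/-- `λ₁(η)`: the infimum of `L (z + t b) / L (z + t₀ b)` over all `z ∈ 𝔹ₙ`, `t₀ ∈ S_z` and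
`|t - t₀| ≤ η / L (z + t₀ b)`. -/
noncomputable def lambdaInf {n : ℕ} (b : EuclideanSpace ℂ (Fin n))
    (L : EuclideanSpace ℂ (Fin n) → ℝ) (η : ℝ) : ℝ≥0∞ :=
  ⨅ z ∈ unitBall n, ⨅ t₀ ∈ sliceDomain b z,
    ⨅ t ∈ Metric.closedBall t₀ (η / L (z + t₀ • b)),
      ENNReal.ofReal (L (z + t • b) / L (z + t₀ • b))

/-- `λ₂(η)`: the supremum of `L (z + t b) / L (z + t₀ b)` over all `z ∈ 𝔹ₙ`, `t₀ ∈ S_z` and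
`|t - t₀| ≤ η / L (z + t₀ b)`. -/
noncomputable def lambdaSup {n : ℕ} (b : EuclideanSpace ℂ (Fin n))
    (L : EuclideanSpace ℂ (Fin n) → ℝ) (η : ℝ) : ℝ≥0∞ :=
  ⨆ z ∈ unitBall n, ⨆ t₀ ∈ sliceDomain b z,
    ⨆ t ∈ Metric.closedBall t₀ (η / L (z + t₀ • b)),
      ENNReal.ofReal (L (z + t • b) / L (z + t₀ • b))

/-- The class `Q_{b,β}(𝔹ₙ)` of positive continuous functions `L` on the unit ball with
`L z > β |b| / (1 - |z|)` and `0 < λ₁(η) ≤ λ₂(η) < ∞` for every `η ∈ [0, β]`. Only the values of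
`L` in the ball matter: by the lower bound the discs in `λ₁`, `λ₂` stay inside the ball. -/
structure MemQ {n : ℕ} (b : EuclideanSpace ℂ (Fin n)) (β : ℝ)
    (L : EuclideanSpace ℂ (Fin n) → ℝ) : Prop where
  continuousOn : ContinuousOn L (unitBall n)
  pos : ∀ z ∈ unitBall n, 0 < L z
  lower_bound : ∀ z ∈ unitBall n, β * ‖b‖ / (1 - ‖z‖) < L z
  lambda : ∀ η ∈ Set.Icc (0 : ℝ) β,
    0 < lambdaInf b L η ∧ lambdaInf b L η ≤ lambdaSup b L η ∧ lambdaSup b L η < ⊤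

/-- The zeros `a ∈ S_{z₀}` of the slice function `t ↦ F (z₀ + t b)`. -/
def sliceZeros {n : ℕ} (b : EuclideanSpace ℂ (Fin n)) (F : EuclideanSpace ℂ (Fin n) → ℂ)
    (z₀ : EuclideanSpace ℂ (Fin n)) : Set ℂ :=
  {a ∈ sliceDomain b z₀ | F (z₀ + a • b) = 0}

open Classical in
/-- `G_r^b(F, z₀)`: the whole slice if the slice function vanishes identically, and otherwise the
union over its zeros `a` of `{z₀ + t b : |t - a| ≤ r / L (z₀ + a b)}` (empty without zeros). -/
noncomputable def sliceExceptionalSet {n : ℕ} (b : EuclideanSpace ℂ (Fin n))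
    (L : EuclideanSpace ℂ (Fin n) → ℝ) (F : EuclideanSpace ℂ (Fin n) → ℂ) (r : ℝ)
    (z₀ : EuclideanSpace ℂ (Fin n)) : Set (EuclideanSpace ℂ (Fin n)) :=
  if ∀ t ∈ sliceDomain b z₀, F (z₀ + t • b) = 0 then
    (fun t : ℂ => z₀ + t • b) '' sliceDomain b z₀
  else
    ⋃ a ∈ sliceZeros b F z₀,
      (fun t : ℂ => z₀ + t • b) '' Metric.closedBall a (r / L (z₀ + a • b))

/-- `G_r^b(F)`: the union of `G_r^b(F, z₀)` over all `z₀ ∈ 𝔹ₙ`. -/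
noncomputable def exceptionalSet {n : ℕ} (b : EuclideanSpace ℂ (Fin n))
    (L : EuclideanSpace ℂ (Fin n) → ℝ) (F : EuclideanSpace ℂ (Fin n) → ℂ) (r : ℝ) :
    Set (EuclideanSpace ℂ (Fin n)) :=
  ⋃ z₀ ∈ unitBall n, sliceExceptionalSet b L F r z₀

/-- `n(ρ, z₀, t₀, 1/F)`: the number, with multiplicity, of zeros `a` of the slice function
`t ↦ F (z₀ + t b)` with `|a - t₀| ≤ ρ`. The sum of the multiplicities is written as the supremum
of its finite partial sums, so that it is `⊤` when there are infinitely many zeros. -/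
noncomputable def zeroCount {n : ℕ} (b : EuclideanSpace ℂ (Fin n))
    (F : EuclideanSpace ℂ (Fin n) → ℂ) (ρ : ℝ) (z₀ : EuclideanSpace ℂ (Fin n)) (t₀ : ℂ) : ℕ∞ :=
  ⨆ (s : Finset ℂ) (_ : (s : Set ℂ) ⊆ sliceZeros b F z₀ ∩ Metric.closedBall t₀ ρ),
    ∑ a ∈ s, analyticOrderAt (fun t : ℂ => F (z₀ + t • b)) a

/-! Put `h(w) = F(z + (w / L(z)) b)`. The quantities in the definition of bounded index at `z` are
the moduli of the Taylor coefficients of `h` at 0, so bounded index says that for every `z` these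
are all dominated by one of index at most `N`, with `N` independent of `z`
(`hasBoundedLIndexInDirection_iff`). The theorem thus reduces to one-variable estimates, uniform in
`h`, on discs of radius slightly larger than `β`. The bounds on `λ₁`, `λ₂` make `L` comparable at
nearby points of a slice, which transfers the estimates between centres.

If the largest coefficient `M` has index at most `N`, then `|h| ≤ 2M` for `|w| ≤ 1/2`, while
Cauchy's estimate prevents `h` from being small on a smaller circle. Many zeros near 0 would make it
small there (`one_le_of_zeros_in_closedBall`); covering a disc of radius `β` by small discs gives
condition 2. If `h` has no zeros near 0, Borel–Carathéodory applied to `log h` gives `M ≤ const ·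
|h(0)|` (`taylorNorm_le_of_ne_zero`), and the coefficient of index 1 gives condition 1.

Conversely, divide `h` by the polynomial of its zeros in `|w| ≤ β`. Condition 1 bounds the
logarithmic derivative of the zero-free quotient on a circle avoiding the zeros, hence inside it, so
the quotient has comparable values at any two points. Therefore `|h|` on a circle of radius `A > 1`
is at most `C` times `|h|` at some point of `|w| ≤ 1/2` away from the zeros, and Cauchy's estimate
makes the high coefficients negligible (`exists_taylorNorm_le_of_logDeriv_le`). -/

/-! ### Taylor coefficients and growth in one variable. -/

/-- The absolute value of the `k`-th Taylor coefficient of `h` at the origin. -/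
noncomputable def taylorNorm (h : ℂ → ℂ) (k : ℕ) : ℝ :=
  ‖iteratedDeriv k h 0‖ / (k.factorial : ℝ)

lemma taylorNorm_nonneg (h : ℂ → ℂ) (k : ℕ) : 0 ≤ taylorNorm h k := by
  unfold taylorNorm; positivity

lemma taylorNorm_zero (h : ℂ → ℂ) : taylorNorm h 0 = ‖h 0‖ := by
  simp [taylorNorm]

/-- Cauchy's estimate. -/
lemma taylorNorm_le_div_pow {h : ℂ → ℂ} {B ρ K : ℝ} (hh : DifferentiableOn ℂ h (Metric.ball 0 B))
    (hρ : 0 < ρ) (hρB : ρ < B) (hK : ∀ w, ‖w‖ = ρ → ‖h w‖ ≤ K) (k : ℕ) :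
    taylorNorm h k ≤ K / ρ ^ k := by
  have h1 := Complex.norm_iteratedDeriv_le_of_forall_mem_sphere_norm_le (f := h) (c := 0) (C := K) k
    hρ (hh.mono (by
      rw [closure_ball _ hρ.ne']
      exact Metric.closedBall_subset_ball hρB)).diffContOnCl (fun z hz => hK z (by simpa using hz))
  unfold taylorNorm
  rw [div_le_iff₀ (by positivity)]
  calc _ ≤ _ := h1
    _ = _ := by ring

/-- Comparison of the Taylor series with a geometric series. It is used for `‖w‖ ≤ 1 / 2`, where the
bound is at most `2 * M`. -/
lemma norm_le_of_taylorNorm_le {h : ℂ → ℂ} {B M : ℝ} (hh : DifferentiableOn ℂ h (Metric.ball 0 B))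
    (hB : 1 ≤ B) (hM : ∀ m, taylorNorm h m ≤ M) {w : ℂ} (hw : ‖w‖ < 1) :
    ‖h w‖ ≤ M * (1 - ‖w‖)⁻¹ := by
  have hs := Complex.hasSum_taylorSeries_on_ball (f := h) (c := 0) (r := B) (z := w)
    hh (by
      rw [mem_ball_zero_iff]
      exact lt_of_lt_of_le hw hB)
  rw [← hs.tsum_eq]
  refine tsum_of_norm_bounded ((hasSum_geometric_of_lt_one (norm_nonneg w) hw).mul_left M) ?_
  intro m
  have : ‖((m.factorial : ℂ)⁻¹ • (w - 0) ^ m • iteratedDeriv m h 0)‖ =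
      taylorNorm h m * ‖w‖ ^ m := by
    simp [taylorNorm]; ring
  rw [this]
  exact mul_le_mul_of_nonneg_right (hM m) (by positivity)

/-! ### Factoring out zeros and holomorphic logarithms. -/

lemma analyticOrderAt_sub_pow_self (a : ℂ) (n : ℕ) :
    analyticOrderAt (fun w : ℂ => (w - a) ^ n) a = n :=
  (AnalyticAt.analyticOrderAt_eq_natCast (by fun_prop)).mpr
    ⟨fun _ => 1, by fun_prop, one_ne_zero, by simp⟩

/-- A function can be divided by `(w - a) ^ n` if it vanishes to order at least `n` at `a`. -/
lemma exists_eq_sub_pow_mul {U : Set ℂ} (hU : IsOpen U) {a : ℂ} (ha : a ∈ U) (n : ℕ) :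
    ∀ {h : ℂ → ℂ}, DifferentiableOn ℂ h U → (n : ℕ∞) ≤ analyticOrderAt h a →
    ∃ φ : ℂ → ℂ, DifferentiableOn ℂ φ U ∧ ∀ w, h w = (w - a) ^ n * φ w := by
  induction n with
  | zero => exact fun {h} hh _ => ⟨h, hh, by simp⟩
  | succ n ih =>
    intro h hh hn
    have h0 : h a = 0 := (analyticOrderAt_ne_zero.mp (fun h0 => by
      rw [h0] at hn; simp at hn)).2
    have hd : DifferentiableOn ℂ (dslope h a) U :=
      (Complex.differentiableOn_dslope (hU.mem_nhds ha)).mpr hh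
    have heq : ∀ w, h w = (w - a) * dslope h a w := fun w => by
      have := sub_smul_dslope h a w
      rw [h0, sub_zero, smul_eq_mul] at this
      exact this.symm
    have hda := hd.analyticAt (hU.mem_nhds ha)
    have hord : analyticOrderAt h a = 1 + analyticOrderAt (dslope h a) a := by
      have : h = (fun w => (w - a) ^ 1) * dslope h a := by
        ext w; simpa using heq w
      conv_lhs => rw [this]
      rw [analyticOrderAt_mul (by fun_prop) hda, analyticOrderAt_sub_pow_self]; simp
    have hn' : (n : ℕ∞) ≤ analyticOrderAt (dslope h a) a := by
      rw [hord, add_comm, Nat.cast_add, Nat.cast_one] at hn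
      exact (ENat.add_le_add_iff_left (ENat.one_ne_top)).mp hn
    obtain ⟨φ, hφ, hφe⟩ := ih hd hn'
    exact ⟨φ, hφ, fun w => by rw [heq w, hφe w]; ring⟩

/-- Division by a product of zeros counted with at most their multiplicities. -/
lemma exists_eq_prod_sub_pow_mul {U : Set ℂ} (hU : IsOpen U) {h : ℂ → ℂ}
    (hh : DifferentiableOn ℂ h U) (n : ℂ → ℕ) (s : Finset ℂ) (hs : ∀ a ∈ s, a ∈ U)
    (hn : ∀ a ∈ s, (n a : ℕ∞) ≤ analyticOrderAt h a) :
    ∃ φ : ℂ → ℂ, DifferentiableOn ℂ φ U ∧ ∀ w, h w = (∏ a ∈ s, (w - a) ^ n a) * φ w := by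
  induction s using Finset.induction_on with
  | empty => exact ⟨h, hh, by simp⟩
  | insert a s has ih =>
    obtain ⟨ψ, hψ, hψe⟩ := ih (fun b hb => hs b (Finset.mem_insert_of_mem hb))
      (fun b hb => hn b (Finset.mem_insert_of_mem hb))
    have haU := hs a (Finset.mem_insert_self a s)
    have hψa := hψ.analyticAt (hU.mem_nhds haU)
    have hprod : AnalyticAt ℂ (fun w => ∏ a ∈ s, (w - a) ^ n a) a := by fun_prop
    have hord : analyticOrderAt h a = analyticOrderAt ψ a := by
      have : h = (fun w => ∏ a ∈ s, (w - a) ^ n a) * ψ := by ext w; exact hψe w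
      rw [this, analyticOrderAt_mul hprod hψa, analyticOrderAt_eq_zero.mpr (Or.inr _), zero_add]
      exact Finset.prod_ne_zero_iff.mpr fun b hb =>
        pow_ne_zero _ (sub_ne_zero.mpr (fun hab => has (hab ▸ hb)))
    obtain ⟨φ, hφ, hφe⟩ := exists_eq_sub_pow_mul hU haU (n a) hψ
      (hord ▸ hn a (Finset.mem_insert_self a s))
    exact ⟨φ, hφ, fun w => by rw [hψe w, hφe w, Finset.prod_insert has]; ring⟩

/-- A zero-free holomorphic function in a disc has a holomorphic logarithm. -/
lemma exists_eq_mul_exp {R : ℝ} {φ : ℂ → ℂ} (hR : 0 < R)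
    (hφ : DifferentiableOn ℂ φ (Metric.ball 0 R)) (h0 : ∀ w ∈ Metric.ball (0 : ℂ) R, φ w ≠ 0) :
    ∃ f : ℂ → ℂ, f 0 = 0 ∧ ∀ w ∈ Metric.ball (0 : ℂ) R,
      HasDerivAt f (deriv φ w / φ w) w ∧ φ w = φ 0 * Complex.exp (f w) := by
  have hq : DifferentiableOn ℂ (fun w => deriv φ w / φ w) (Metric.ball 0 R) :=
    (hφ.deriv Metric.isOpen_ball).div hφ h0
  obtain ⟨f, hf0, hf⟩ := hq.isExactOn_ball.with_val_at 0 0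
  have hder : ∀ w ∈ Metric.ball (0 : ℂ) R,
      HasDerivAt (fun w => φ w * Complex.exp (-f w)) 0 w := fun w hw => by
    have h1 := (hφ.differentiableAt (Metric.isOpen_ball.mem_nhds hw)).hasDerivAt.mul
      (hf w hw).neg.cexp
    refine h1.congr_deriv ?_
    have := h0 w hw
    rw [show deriv φ w = φ w * (deriv φ w / φ w) by field_simp]
    simp only [mul_div_cancel_left₀ _ this]
    ring
  refine ⟨f, hf0, fun w hw => ⟨hf w hw, ?_⟩⟩
  have hc := Metric.isOpen_ball.is_const_of_deriv_eq_zero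
    (convex_ball (0 : ℂ) R).isPreconnected
    (fun w hw => (hder w hw).differentiableAt.differentiableWithinAt)
    (fun w hw => (hder w hw).deriv) hw (Metric.mem_ball_self hR)
  simp only [hf0, neg_zero, Complex.exp_zero, mul_one] at hc
  rw [← hc, mul_assoc, ← Complex.exp_add]
  simp

lemma norm_prod_sub_pow_le {s : Finset ℂ} (n : ℂ → ℕ) {w : ℂ} {D : ℝ}
    (hD : ∀ a ∈ s, ‖w - a‖ ≤ D) : ‖∏ a ∈ s, (w - a) ^ n a‖ ≤ D ^ ∑ a ∈ s, n a := by
  rw [norm_prod, ← Finset.prod_pow_eq_pow_sum]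
  refine Finset.prod_le_prod (fun a _ => norm_nonneg _) fun a ha => ?_
  rw [norm_pow]
  exact pow_le_pow_left₀ (norm_nonneg _) (hD a ha) _

lemma le_norm_prod_sub_pow {s : Finset ℂ} (n : ℂ → ℕ) {w : ℂ} {d : ℝ} (hd : 0 ≤ d)
    (hdw : ∀ a ∈ s, d ≤ ‖w - a‖) : d ^ ∑ a ∈ s, n a ≤ ‖∏ a ∈ s, (w - a) ^ n a‖ := by
  rw [norm_prod, ← Finset.prod_pow_eq_pow_sum]
  refine Finset.prod_le_prod (fun a _ => by positivity) fun a ha => ?_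
  rw [norm_pow]
  exact pow_le_pow_left₀ hd (hdw a ha) _

lemma norm_le_on_closedBall {φ : ℂ → ℂ} {B R C : ℝ} (hφ : DifferentiableOn ℂ φ (Metric.ball 0 B))
    (hR : 0 < R) (hRB : R < B) (hC : ∀ w, ‖w‖ = R → ‖φ w‖ ≤ C) {w : ℂ} (hw : ‖w‖ ≤ R) :
    ‖φ w‖ ≤ C := by
  refine Complex.norm_le_of_forall_mem_frontier_norm_le (U := Metric.ball 0 R)
    Metric.isBounded_ball (hφ.mono ?_).diffContOnCl (fun z hz => hC z ?_) ?_
  · rw [closure_ball _ hR.ne']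
    exact Metric.closedBall_subset_ball hRB
  · rw [frontier_ball _ hR.ne'] at hz
    simpa using hz
  · rw [closure_ball _ hR.ne']
    simpa using hw

/-! ### Consequences of a dominating coefficient of low index. -/

/-- If the Taylor coefficients at the origin are dominated by one of index at most `N`, then the
number of zeros in the disc of radius `1 / 8` is controlled by `N`. -/
lemma one_le_of_zeros_in_closedBall {h : ℂ → ℂ} {B : ℝ} {N k₀ : ℕ}
    (hh : DifferentiableOn ℂ h (Metric.ball 0 B)) (hB : 1 ≤ B) (hk₀ : k₀ ≤ N)
    (hdom : ∀ m, taylorNorm h m ≤ taylorNorm h k₀) (hpos : 0 < taylorNorm h k₀)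
    (s : Finset ℂ) (n : ℂ → ℕ) (hs : ∀ a ∈ s, ‖a‖ ≤ 1 / 8)
    (hn : ∀ a ∈ s, (n a : ℕ∞) ≤ analyticOrderAt h a) :
    1 ≤ 2 * 8 ^ N * (2 / 3 : ℝ) ^ ∑ a ∈ s, n a := by
  obtain ⟨φ, hφ, hφe⟩ := exists_eq_prod_sub_pow_mul Metric.isOpen_ball hh n s
    (fun a ha => by rw [mem_ball_zero_iff]; linarith [hs a ha]) hn
  set M := taylorNorm h k₀
  set p := ∑ a ∈ s, n a
  -- On `|z| = 1/2` each factor `z - a` has modulus at least `1/2 - 1/8 = 3/8` and `|h| ≤ 2M`; the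
  -- maximum principle carries the bound for `φ` inwards. On `|w| = 1/8` each factor is at most
  -- `1/4`, so every zero gains a factor `(1/4) / (3/8) = 2/3`.
  have hφ_le : ∀ w : ℂ, ‖w‖ ≤ 1 / 2 → ‖φ w‖ ≤ 2 * M / (3 / 8) ^ p := fun w hw => by
    refine norm_le_on_closedBall hφ (by norm_num) (by linarith) (fun z hz => ?_) hw
    have h1 : (3 / 8 : ℝ) ^ p ≤ ‖∏ a ∈ s, (z - a) ^ n a‖ :=
      le_norm_prod_sub_pow n (by norm_num) fun a ha => by
        linarith [norm_sub_norm_le z a, hs a ha]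
    have h2 := norm_le_of_taylorNorm_le hh hB hdom (w := z) (by rw [hz]; norm_num)
    rw [hz, hφe z, norm_mul] at h2
    rw [le_div_iff₀ (by positivity)]
    calc ‖φ z‖ * (3 / 8) ^ p ≤ ‖φ z‖ * ‖∏ a ∈ s, (z - a) ^ n a‖ := by gcongr
      _ ≤ 2 * M := by linarith
  have hh_le : ∀ w : ℂ, ‖w‖ = 1 / 8 → ‖h w‖ ≤ 2 * M * (2 / 3) ^ p := fun w hw => by
    have h1 : ‖∏ a ∈ s, (w - a) ^ n a‖ ≤ (1 / 4 : ℝ) ^ p :=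
      norm_prod_sub_pow_le n fun a ha => by linarith [norm_sub_le w a, hs a ha]
    rw [hφe w, norm_mul]
    calc _ ≤ (1 / 4 : ℝ) ^ p * (2 * M / (3 / 8) ^ p) :=
          mul_le_mul h1 (hφ_le w (by rw [hw]; norm_num)) (norm_nonneg _) (by positivity)
      _ = 2 * M * ((1 / 4) / (3 / 8)) ^ p := by
        rw [div_pow (1 / 4 : ℝ) (3 / 8)]; ring
      _ = 2 * M * (2 / 3) ^ p := by norm_num
  have hc := taylorNorm_le_div_pow hh (by norm_num) (by linarith) hh_le k₀
  have : M ≤ 2 * 8 ^ N * (2 / 3 : ℝ) ^ p * M := by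
    calc M ≤ 2 * M * (2 / 3) ^ p / (1 / 8) ^ k₀ := hc
      _ = 2 * M * (2 / 3) ^ p * 8 ^ k₀ := by rw [one_div, inv_pow, div_inv_eq_mul]
      _ ≤ 2 * M * (2 / 3) ^ p * 8 ^ N := by gcongr; norm_num
      _ = _ := by ring
  exact le_of_mul_le_mul_right (by linarith) hpos

/-- Since `(2/3)^p` tends to 0, the inequality of `one_le_of_zeros_in_closedBall` bounds the number
of zeros in terms of `N` alone. -/
lemma exists_zeroBound (N : ℕ) :
    ∃ q : ℕ, ∀ p : ℕ, 1 ≤ 2 * 8 ^ N * (2 / 3 : ℝ) ^ p → p ≤ q := by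
  obtain ⟨q, hq⟩ := exists_pow_lt_of_lt_one (x := 1 / (2 * 8 ^ N : ℝ)) (by positivity)
    (show (2 / 3 : ℝ) < 1 by norm_num)
  refine ⟨q, fun p hp => ?_⟩
  by_contra! hlt
  have h1 : (2 / 3 : ℝ) ^ p ≤ (2 / 3 : ℝ) ^ q :=
    pow_le_pow_of_le_one (by norm_num) (by norm_num) hlt.le
  rw [lt_div_iff₀ (by positivity)] at hq
  nlinarith [show (0 : ℝ) < 2 * 8 ^ N by positivity]

/-- Lower bound at the centre for a zero-free function whose Taylor coefficients are dominated by
one of index at most `N`. -/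
lemma taylorNorm_le_of_ne_zero {h : ℂ → ℂ} {B s : ℝ} {N k₀ : ℕ}
    (hh : DifferentiableOn ℂ h (Metric.ball 0 B)) (hB : 1 ≤ B) (hk₀ : k₀ ≤ N)
    (hdom : ∀ m, taylorNorm h m ≤ taylorNorm h k₀) (hs : 0 < s) (hs2 : s ≤ 1 / 2)
    (hne : ∀ w ∈ Metric.ball (0 : ℂ) s, h w ≠ 0) :
    taylorNorm h k₀ ≤ 2 * (5 / s) ^ (2 * N) * ‖h 0‖ := by
  set M := taylorNorm h k₀
  have h0 : 0 < ‖h 0‖ := norm_pos_iff.mpr (hne 0 (Metric.mem_ball_self hs))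
  have h0M : ‖h 0‖ ≤ M := taylorNorm_zero h ▸ hdom 0
  have hMpos : 0 < M := h0.trans_le h0M
  obtain ⟨f, hf0, hf⟩ := exists_eq_mul_exp hs
    (hh.mono (Metric.ball_subset_ball (by linarith))) hne
  -- With `h = h(0) exp f`, the bound `|h| ≤ 2M` says exactly `Re f ≤ A`, which is the input of
  -- Borel–Carathéodory.
  set A := Real.log (2 * M / ‖h 0‖)
  have hq1 : 1 < 2 * M / ‖h 0‖ := by rw [lt_div_iff₀ h0]; linarith
  have hA : 0 < A := Real.log_pos hq1
  have hexpA : Real.exp A = 2 * M / ‖h 0‖ := Real.exp_log (by linarith)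
  have hmaps : Set.MapsTo f (Metric.ball 0 s) {z | z.re ≤ A} := fun w hw => by
    have hws : ‖w‖ < s := by simpa using hw
    have h1 := norm_le_of_taylorNorm_le hh hB hdom (w := w) (by linarith)
    have h2 : ‖h w‖ ≤ 2 * M := by
      have h3 : (1 - ‖w‖)⁻¹ ≤ 2 := by
        rw [inv_le_comm₀ (by linarith) (by norm_num)]; linarith
      calc _ ≤ _ := h1
        _ ≤ M * 2 := by gcongr
        _ = _ := by ring
    rw [(hf w hw).2, norm_mul, Complex.norm_exp] at h2
    show (f w).re ≤ A
    rw [← Real.exp_le_exp, hexpA, le_div_iff₀ h0]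
    linarith
  have hsm : ∀ w : ℂ, ‖w‖ = s / 5 → ‖h w‖ ≤ ‖h 0‖ * Real.exp (A / 2) := fun w hw => by
    have hws : w ∈ Metric.ball (0 : ℂ) s := by rw [mem_ball_zero_iff, hw]; linarith
    have h1 := Complex.borelCaratheodory_zero hA
      (fun w hw => (hf w hw).1.differentiableAt.differentiableWithinAt) hmaps hs hws hf0
    rw [hw] at h1
    -- The radius `s / 5` is chosen to give `|f| ≤ A / 2`, that is `|h| ≤ sqrt(2M |h(0)|)`. The
    -- exponent `1/2` of `M` is what lets the final inequality be solved for `M` after squaring.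
    have h2 : 2 * A * (s / 5) / (s - s / 5) = A / 2 := by
      have : s - s / 5 ≠ 0 := by linarith
      field_simp
      norm_num
    rw [(hf w hws).2, norm_mul, Complex.norm_exp]
    gcongr
    linarith [Complex.re_le_norm (f w)]
  have hc := taylorNorm_le_div_pow hh (by positivity) (by linarith) hsm k₀
  have hpow : 1 ≤ (5 / s) := by rw [le_div_iff₀ hs]; linarith
  have h1 : M ≤ ‖h 0‖ * Real.exp (A / 2) * (5 / s) ^ N := by
    calc M ≤ _ := hc
      _ = ‖h 0‖ * Real.exp (A / 2) * (5 / s) ^ k₀ := by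
        rw [div_eq_mul_inv, ← inv_pow, inv_div]
      _ ≤ _ := by gcongr
  have h2 : M ^ 2 ≤ 2 * M * ‖h 0‖ * (5 / s) ^ (2 * N) := by
    calc M ^ 2 ≤ (‖h 0‖ * Real.exp (A / 2) * (5 / s) ^ N) ^ 2 := by gcongr
      _ = ‖h 0‖ ^ 2 * (Real.exp (A / 2) * Real.exp (A / 2)) * (5 / s) ^ (2 * N) := by ring
      _ = ‖h 0‖ ^ 2 * (2 * M / ‖h 0‖) * (5 / s) ^ (2 * N) := by
        rw [← Real.exp_add, add_halves, hexpA]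
      _ = _ := by field_simp
  nlinarith

/-! ### From zeros and the logarithmic derivative to a dominating coefficient. -/

/-- If `h` is controlled in a disc of radius larger than one by its value at a point of the disc
of radius `1 / 2`, then its Taylor coefficients are dominated by the first ones. -/
lemma exists_taylorNorm_le_of_norm_le {h : ℂ → ℂ} {A B C : ℝ} {N : ℕ}
    (hh : DifferentiableOn ℂ h (Metric.ball 0 B)) (hA : 1 ≤ A) (hAB : A < B)
    (hN : 4 * C ≤ A ^ N) {w₀ : ℂ} (hw₀ : ‖w₀‖ ≤ 1 / 2)
    (hC : ∀ w, ‖w‖ = A → ‖h w‖ ≤ C * ‖h w₀‖) (m : ℕ) :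
    ∃ k ≤ N, taylorNorm h m ≤ taylorNorm h k := by
  obtain ⟨k, hk, hmax⟩ := Finset.exists_max_image (Finset.range (N + 1)) (taylorNorm h)
    Finset.nonempty_range_add_one
  simp only [Finset.mem_range, Nat.lt_succ_iff] at hk hmax
  refine ⟨k, hk, ?_⟩
  rcases le_or_gt m N with hm | hm
  · exact hmax m hm
  -- Cauchy's estimate on `|w| = A` gives `C |h(w₀)| / A^j`, and `4C ≤ A^N`.
  have htail : ∀ j, N < j → taylorNorm h j ≤ ‖h w₀‖ / 4 := fun j hj => by
    refine (taylorNorm_le_div_pow hh (by linarith) hAB hC j).trans ?_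
    rw [div_le_iff₀ (by positivity)]
    have h1 : A ^ N ≤ A ^ j := pow_le_pow_right₀ hA hj.le
    nlinarith [norm_nonneg (h w₀)]
  have hall : ∀ j, taylorNorm h j ≤ taylorNorm h k + ‖h w₀‖ / 4 := fun j => by
    rcases le_or_gt j N with hj | hj
    · linarith [hmax j hj, norm_nonneg (h w₀)]
    · linarith [htail j hj, taylorNorm_nonneg h k]
  have h1 := norm_le_of_taylorNorm_le hh (by linarith) hall (w := w₀) (by linarith)
  have h2 : (1 - ‖w₀‖)⁻¹ ≤ 2 := by
    rw [inv_le_comm₀ (by linarith) (by norm_num)]; linarith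
  have h3 : 0 ≤ taylorNorm h k + ‖h w₀‖ / 4 :=
    add_nonneg (taylorNorm_nonneg h k) (by positivity)
  -- The tail term on the right is absorbed on the left: `|h(w₀)| / 4` is at most the largest of the
  -- first coefficients, hence so is every later coefficient.
  have h4 : ‖h w₀‖ ≤ (taylorNorm h k + ‖h w₀‖ / 4) * 2 := h1.trans (by gcongr)
  linarith [htail m hm]

/-- Among finitely many reals one cannot be close to every point of an interval. -/
lemma exists_mem_Icc_forall_le_abs_sub {α : Type*} (s : Finset α) (y : α → ℝ) {q : ℕ}
    (hs : s.card ≤ q) {A B : ℝ} (hAB : A < B) :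
    ∃ x ∈ Set.Icc A B, ∀ a ∈ s, (B - A) / (2 * (q + 1)) ≤ |x - y a| := by
  set d := (B - A) / (2 * (q + 1)) with hd
  have hd0 : 0 < d := div_pos (by linarith) (by positivity)
  have hBA : B = A + d * (2 * (q + 1)) := by rw [hd]; field_simp; ring
  -- These are the midpoints of `q + 1` equal subintervals of length `2d`. If each were closer than
  -- `d` to some `y a`, two of them would share the same `a` and be less than `2d` apart.
  let x : ℕ → ℝ := fun i => A + (2 * i + 1) * d
  by_contra! H
  have hx : ∀ i ∈ Finset.range (q + 1), x i ∈ Set.Icc A B := fun i hi => by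
    have h1 : (i : ℝ) ≤ q := by
      exact_mod_cast Nat.lt_succ_iff.mp (Finset.mem_range.mp hi)
    refine ⟨?_, ?_⟩
    · have : 0 ≤ (2 * (i : ℝ) + 1) * d := by positivity
      simp only [x]; linarith
    · simp only [x]; rw [hBA]; nlinarith
  obtain ⟨a₀, -, -⟩ := H (x 0) (hx 0 (by simp))
  have : Nonempty α := ⟨a₀⟩
  choose! g hg hlt using fun i hi => H (x i) (hx i hi)
  obtain ⟨i, hi, j, hj, hij, hgij⟩ := Finset.exists_ne_map_eq_of_card_lt_of_maps_to
    (s := Finset.range (q + 1)) (t := s) (by rw [Finset.card_range]; omega) (f := g)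
    (fun i hi => hg i hi)
  have h1 := hlt i hi
  have h2 := hlt j hj
  rw [hgij] at h1
  have h3 : |x i - x j| < 2 * d := by
    calc |x i - x j| = |(x i - y (g j)) - (x j - y (g j))| := by ring_nf
      _ ≤ |x i - y (g j)| + |x j - y (g j)| := abs_sub _ _
      _ < 2 * d := by linarith
  have h4 : x i - x j = (((i : ℤ) - (j : ℤ) : ℤ) : ℝ) * (2 * d) := by simp only [x]; push_cast; ring
  have h5 : (1 : ℝ) ≤ |(((i : ℤ) - (j : ℤ) : ℤ) : ℝ)| := by
    have h6 : (1 : ℤ) ≤ |(i : ℤ) - (j : ℤ)| :=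
      Int.one_le_abs (sub_ne_zero.mpr (by exact_mod_cast hij))
    rw [← Int.cast_abs]
    exact_mod_cast h6
  rw [h4, abs_mul, abs_of_pos (show 0 < 2 * d by linarith)] at h3
  nlinarith

lemma logDeriv_prod_sub_pow {s : Finset ℂ} (n : ℂ → ℕ) {w : ℂ} (hw : ∀ a ∈ s, w - a ≠ 0) :
    logDeriv (fun w => ∏ a ∈ s, (w - a) ^ n a) w = ∑ a ∈ s, n a / (w - a) := by
  rw [logDeriv_prod (f := fun a w => (w - a) ^ n a) (fun a ha => pow_ne_zero _ (hw a ha))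
    (fun a _ => by fun_prop)]
  refine Finset.sum_congr rfl fun a _ => ?_
  rw [logDeriv_fun_pow (by fun_prop)]
  simp [logDeriv_apply, div_eq_mul_inv]

/-- Bounds for the number of zeros of `h` in a disc of radius larger than one and for its
logarithmic derivative away from these zeros give a bound for the index of `h` at the centre. -/
lemma exists_taylorNorm_le_of_logDeriv_le {β : ℝ} (hβ : 1 < β) (q : ℕ) :
    ∃ δ : ℝ, 0 < δ ∧ ∀ K : ℝ, 0 ≤ K → ∃ N : ℕ, ∀ (B : ℝ) (h φ : ℂ → ℂ) (s : Finset ℂ) (n : ℂ → ℕ),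
      β < B → DifferentiableOn ℂ h (Metric.ball 0 B) → DifferentiableOn ℂ φ (Metric.ball 0 B) →
      (∀ w, h w = (∏ a ∈ s, (w - a) ^ n a) * φ w) → (∀ a ∈ s, ‖a‖ ≤ β) →
      s.card ≤ q → ∑ a ∈ s, n a ≤ q → (∀ w, ‖w‖ ≤ β → φ w ≠ 0) →
      (∀ w, ‖w‖ ≤ (1 + β) / 2 → (∀ a ∈ s, δ ≤ ‖w - a‖) → ‖deriv h w‖ ≤ K * ‖h w‖) →
      ∀ m, ∃ k ≤ N, taylorNorm h m ≤ taylorNorm h k := by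
  set A : ℝ := 1 + (β - 1) / 4 with hA
  have hA1 : 1 < A := by linarith
  have hAR : A < (1 + β) / 2 := by linarith
  -- `δ` depends only on `β` and `q`, not on `K`: in the application the radius `r` is chosen from
  -- `δ`, and `K` comes from the constant `P(r)`.
  set δ : ℝ := ((1 + β) / 2 - A) / (2 * (q + 1)) with hδ
  have hδ0 : 0 < δ := div_pos (by linarith) (by positivity)
  refine ⟨δ, hδ0, fun K hK => ?_⟩
  set d : ℝ := (1 / 2 - 0) / (2 * (q + 1)) with hd
  have hd0 : 0 < d := by positivity
  have hd1 : d ≤ 1 := by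
    rw [hd, div_le_one (by positivity)]; linarith [show (0 : ℝ) ≤ q by positivity]
  set K' : ℝ := K + q / δ with hK'
  have hK'0 : 0 ≤ K' := by positivity
  set C : ℝ := (2 * β) ^ q * Real.exp (K' * (2 * β)) / d ^ q with hC
  obtain ⟨N, hN⟩ := pow_unbounded_of_one_lt (4 * C) hA1
  refine ⟨N, fun B h φ s n hB hh hφ hφe hs hcard hsum hne hder => ?_⟩
  -- The circle `|w| = x` stays at distance `δ` from all zeros because the moduli do; the real point
  -- `y` stays at distance `d` because the real parts do.
  obtain ⟨x, ⟨hAx, hxR⟩, hx⟩ := exists_mem_Icc_forall_le_abs_sub s (fun a => ‖a‖) hcard hAR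
  obtain ⟨y, ⟨hy0, hy1⟩, hy⟩ := exists_mem_Icc_forall_le_abs_sub s Complex.re hcard
    (show (0 : ℝ) < 1 / 2 by norm_num)
  have hφβ : DifferentiableOn ℂ φ (Metric.ball 0 β) := hφ.mono (Metric.ball_subset_ball hB.le)
  have hneβ : ∀ w ∈ Metric.ball (0 : ℂ) β, φ w ≠ 0 := fun w hw =>
    hne w (by rw [mem_ball_zero_iff] at hw; exact hw.le)
  -- On this circle `φ'/φ = h'/h - ∑ n a / (w - a)`, and each of the two terms is bounded there.
  have hcirc : ∀ w : ℂ, ‖w‖ = x → ‖deriv φ w / φ w‖ ≤ K' := fun w hw => by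
    have hdist : ∀ a ∈ s, δ ≤ ‖w - a‖ := fun a ha => by
      have := abs_norm_sub_norm_le w a
      rw [hw] at this
      exact (hx a ha).trans this
    have hwa : ∀ a ∈ s, w - a ≠ 0 := fun a ha =>
      norm_pos_iff.mp (hδ0.trans_le (hdist a ha))
    have hwφ := hne w (by linarith)
    have hprod : (∏ a ∈ s, (w - a) ^ n a) ≠ 0 :=
      Finset.prod_ne_zero_iff.mpr fun a ha => pow_ne_zero _ (hwa a ha)
    have hhw : h w ≠ 0 := by rw [hφe w]; exact mul_ne_zero hprod hwφ
    have hlog : logDeriv h w = ∑ a ∈ s, n a / (w - a) + logDeriv φ w := by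
      rw [show h = fun w => (∏ a ∈ s, (w - a) ^ n a) * φ w from funext hφe,
        logDeriv_mul w hprod hwφ (by fun_prop)
          (hφβ.differentiableAt (Metric.isOpen_ball.mem_nhds (by
            rw [mem_ball_zero_iff]; linarith))), logDeriv_prod_sub_pow n hwa]
    have h1 : ‖logDeriv h w‖ ≤ K := by
      rw [logDeriv_apply, norm_div, div_le_iff₀ (norm_pos_iff.mpr hhw)]
      exact hder w (by linarith) hdist
    have h2 : ‖∑ a ∈ s, (n a : ℂ) / (w - a)‖ ≤ q / δ := by
      refine (norm_sum_le _ _).trans ?_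
      calc ∑ a ∈ s, ‖(n a : ℂ) / (w - a)‖ ≤ ∑ a ∈ s, (n a : ℝ) / δ := by
            refine Finset.sum_le_sum fun a ha => ?_
            rw [norm_div, Complex.norm_natCast]
            have := hdist a ha
            gcongr
        _ = ((∑ a ∈ s, n a : ℕ) : ℝ) / δ := by rw [← Finset.sum_div]; push_cast; rfl
        _ ≤ q / δ := by gcongr
    rw [← logDeriv_apply, show logDeriv φ w = logDeriv h w - ∑ a ∈ s, (n a : ℂ) / (w - a) by
      rw [hlog]; ring]
    exact (norm_sub_le _ _).trans (add_le_add h1 h2)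
  have hq : DifferentiableOn ℂ (fun w => deriv φ w / φ w) (Metric.ball 0 β) :=
    (hφβ.deriv Metric.isOpen_ball).div hφβ hneβ
  obtain ⟨f, -, hf⟩ := exists_eq_mul_exp (by linarith) hφβ hneβ
  have hdisc : ∀ w : ℂ, ‖w‖ ≤ x → w ∈ Metric.ball (0 : ℂ) β := fun w hw => by
    rw [mem_ball_zero_iff]; linarith
  -- Since `φ` has no zeros, `φ'/φ` is holomorphic and the maximum principle extends the bound `K'`
  -- to the disc, even near the zeros of `h`. The mean value inequality for `log φ` then compares
  -- any two values of `φ`.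
  have hcomp : ∀ w w' : ℂ, ‖w‖ ≤ x → ‖w'‖ ≤ x →
      ‖φ w‖ ≤ Real.exp (K' * (2 * β)) * ‖φ w'‖ := fun w w' hw hw' => by
    have h1 : ‖f w - f w'‖ ≤ K' * ‖w - w'‖ :=
      (convex_closedBall (0 : ℂ) x).norm_image_sub_le_of_norm_hasDerivWithin_le
        (fun z hz => ((hf z (hdisc z (by simpa using hz))).1).hasDerivWithinAt)
        (fun z hz => norm_le_on_closedBall hq (by linarith) (by linarith) hcirc (by simpa using hz))
        (by simpa using hw') (by simpa using hw)
    have h2 : ‖f w - f w'‖ ≤ K' * (2 * β) := h1.trans (by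
      gcongr
      linarith [norm_sub_le w w'])
    have h3 : φ w = Complex.exp (f w - f w') * φ w' := by
      rw [(hf w (hdisc w hw)).2, (hf w' (hdisc w' hw')).2, Complex.exp_sub]
      have := Complex.exp_ne_zero (f w')
      field_simp
    rw [h3, norm_mul, Complex.norm_exp]
    gcongr
    exact (Complex.re_le_norm _).trans h2
  have hw₀ : ‖(y : ℂ)‖ ≤ 1 / 2 := by
    rw [Complex.norm_real, Real.norm_eq_abs, abs_of_nonneg hy0]; exact hy1
  have hlow : d ^ q * ‖φ y‖ ≤ ‖h y‖ := by
    rw [hφe y, norm_mul]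
    gcongr
    refine le_trans (pow_le_pow_of_le_one hd0.le hd1 hsum) (le_norm_prod_sub_pow n hd0.le ?_)
    intro a ha
    refine (hy a ha).trans ?_
    have := Complex.abs_re_le_norm ((y : ℂ) - a)
    simpa using this
  refine exists_taylorNorm_le_of_norm_le hh hA1.le (by linarith) hN.le hw₀ fun w hw => ?_
  calc ‖h w‖ ≤ (2 * β) ^ q * ‖φ w‖ := by
        rw [hφe w, norm_mul]
        gcongr
        refine (norm_prod_sub_pow_le n (D := 2 * β) fun a ha => ?_).trans
          (pow_le_pow_right₀ (by linarith) hsum)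
        linarith [norm_sub_le w a, hs a ha]
    _ ≤ (2 * β) ^ q * (Real.exp (K' * (2 * β)) * ‖φ y‖) := by
        gcongr
        exact hcomp w y (by linarith) (by linarith)
    _ = C * (d ^ q * ‖φ y‖) := by rw [hC]; field_simp
    _ ≤ C * ‖h y‖ := by gcongr

/-! ### Slices of `F` and their rescaling by `L`. -/

section Slices

variable {n : ℕ} {b : EuclideanSpace ℂ (Fin n)} {β : ℝ} {L : EuclideanSpace ℂ (Fin n) → ℝ}
  {F : EuclideanSpace ℂ (Fin n) → ℂ}

lemma iterDirDeriv_analyticOnNhd (hF : AnalyticOnNhd ℂ F (unitBall n))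
    (b : EuclideanSpace ℂ (Fin n)) (k : ℕ) :
    AnalyticOnNhd ℂ (iterDirDeriv b k F) (unitBall n) := by
  induction k with
  | zero => exact hF
  | succ k ih =>
    exact fun z hz => ((ContinuousLinearMap.apply ℂ ℂ b).analyticAt _).comp (ih.fderiv z hz)

lemma iterDirDeriv_smul (c : ℂ) (b : EuclideanSpace ℂ (Fin n))
    (F : EuclideanSpace ℂ (Fin n) → ℂ) (k : ℕ) :
    iterDirDeriv (c • b) k F = fun z => c ^ k * iterDirDeriv b k F z := by
  induction k with
  | zero => simp [iterDirDeriv]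
  | succ k ih =>
    ext z
    have : (fun z => c ^ k * iterDirDeriv b k F z) = (c ^ k) • iterDirDeriv b k F := rfl
    simp only [iterDirDeriv, dirDeriv, ih, this, fderiv_const_smul_field]
    simp [pow_succ]
    ring

lemma isOpen_sliceDomain (b z : EuclideanSpace ℂ (Fin n)) : IsOpen (sliceDomain b z) :=
  Metric.isOpen_ball.preimage (f := fun t : ℂ => z + t • b) (by fun_prop)

lemma convex_sliceDomain (b z : EuclideanSpace ℂ (Fin n)) : Convex ℝ (sliceDomain b z) := by
  intro x hx y hy α γ hα hγ hαγ
  have h1 := convex_ball (0 : EuclideanSpace ℂ (Fin n)) 1 hx hy hα hγ hαγ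
  show z + (α • x + γ • y) • b ∈ Metric.ball 0 1
  convert h1 using 1
  rw [smul_add, smul_add, add_add_add_comm, ← add_smul, hαγ, one_smul, add_smul, smul_assoc,
    smul_assoc]

lemma analyticAt_slice (hF : AnalyticOnNhd ℂ F (unitBall n)) {z : EuclideanSpace ℂ (Fin n)} {t : ℂ}
    (ht : t ∈ sliceDomain b z) : AnalyticAt ℂ (fun t : ℂ => F (z + t • b)) t :=
  AnalyticAt.comp (f := fun t : ℂ => z + t • b) (hF _ ht) (by fun_prop)

lemma iteratedDeriv_slice (hF : AnalyticOnNhd ℂ F (unitBall n)) (z : EuclideanSpace ℂ (Fin n))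
    (k : ℕ) : ∀ t ∈ sliceDomain b z,
      iteratedDeriv k (fun t : ℂ => F (z + t • b)) t = iterDirDeriv b k F (z + t • b) := by
  induction k with
  | zero => simp [iterDirDeriv]
  | succ k ih =>
    intro t ht
    have hev : iteratedDeriv k (fun t : ℂ => F (z + t • b)) =ᶠ[nhds t]
        fun t => iterDirDeriv b k F (z + t • b) :=
      Filter.eventually_of_mem ((isOpen_sliceDomain b z).mem_nhds ht) ih
    rw [iteratedDeriv_succ, hev.deriv_eq]
    have h1 := (iterDirDeriv_analyticOnNhd hF b k _ ht).differentiableAt.hasFDerivAt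
    have h2 : HasDerivAt (fun t : ℂ => z + t • b) b t := by
      simpa using ((hasDerivAt_id t).smul_const b).const_add z
    exact (h1.comp_hasDerivAt t h2).deriv

/-- The slice function of `F` at `z` in the direction `b`, with the parameter rescaled by `L z`. -/
noncomputable def rescaledSlice (b : EuclideanSpace ℂ (Fin n)) (L : EuclideanSpace ℂ (Fin n) → ℝ)
    (F : EuclideanSpace ℂ (Fin n) → ℂ) (z : EuclideanSpace ℂ (Fin n)) : ℂ → ℂ :=
  fun w => F (z + (w / L z) • b)

lemma rescaledSlice_eq_slice (b : EuclideanSpace ℂ (Fin n)) (L : EuclideanSpace ℂ (Fin n) → ℝ)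
    (F : EuclideanSpace ℂ (Fin n) → ℂ) (z : EuclideanSpace ℂ (Fin n)) :
    rescaledSlice b L F z = fun w : ℂ => F (z + w • ((L z : ℂ)⁻¹ • b)) := by
  ext w
  rw [rescaledSlice, smul_smul, div_eq_mul_inv]

/-- Rescaling replaces the direction `b` by `b / L(z)`, so the derivative of order `k` acquires the
factor `L(z)^(-k)`. -/
lemma taylorNorm_rescaledSlice (hF : AnalyticOnNhd ℂ F (unitBall n))
    {z : EuclideanSpace ℂ (Fin n)} (hz : z ∈ unitBall n) (hLz : 0 < L z) (k : ℕ) :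
    taylorNorm (rescaledSlice b L F z) k =
      ‖iterDirDeriv b k F z‖ / ((k.factorial : ℝ) * L z ^ k) := by
  rw [taylorNorm, rescaledSlice_eq_slice, iteratedDeriv_slice hF z k 0 (by simpa [sliceDomain]),
    iterDirDeriv_smul]
  simp [abs_of_pos hLz]
  field_simp

lemma hasBoundedLIndexInDirection_iff (hF : AnalyticOnNhd ℂ F (unitBall n)) (hL : MemQ b β L) :
    HasBoundedLIndexInDirection b L F ↔ ∃ N : ℕ, ∀ z ∈ unitBall n, ∀ m, ∃ k ≤ N,
      taylorNorm (rescaledSlice b L F z) m ≤ taylorNorm (rescaledSlice b L F z) k := by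
  refine exists_congr fun N => ⟨fun h z hz m => ?_, fun h m z hz => ?_⟩
  · have h1 := h m z hz
    rw [Finset.le_sup'_iff] at h1
    obtain ⟨k, hk, h2⟩ := h1
    refine ⟨k, Nat.lt_succ_iff.mp (Finset.mem_range.mp hk), ?_⟩
    rwa [taylorNorm_rescaledSlice hF hz (hL.pos z hz), taylorNorm_rescaledSlice hF hz (hL.pos z hz)]
  · rw [Finset.le_sup'_iff]
    obtain ⟨k, hk, h2⟩ := h z hz m
    rw [taylorNorm_rescaledSlice hF hz (hL.pos z hz),
      taylorNorm_rescaledSlice hF hz (hL.pos z hz)] at h2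
    exact ⟨k, Finset.mem_range.mpr (Nat.lt_succ_iff.mpr hk), h2⟩

/-- The lower bound on `L` is strict, so the slice contains a disc of rescaled radius larger than
`β`. The radius `B` may depend on `z`; no later constant depends on it. -/
lemma MemQ.exists_lt_forall_mem_sliceDomain (hL : MemQ b β L) (hb : b ≠ 0)
    {z : EuclideanSpace ℂ (Fin n)} (hz : z ∈ unitBall n) :
    ∃ B, β < B ∧ ∀ w : ℂ, ‖w‖ < B → w / L z ∈ sliceDomain b z := by
  have hz1 : ‖z‖ < 1 := by simpa [unitBall] using hz
  have hb0 : 0 < ‖b‖ := norm_pos_iff.mpr hb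
  have hLz := hL.pos z hz
  refine ⟨L z * (1 - ‖z‖) / ‖b‖, ?_, fun w hw => ?_⟩
  · have := hL.lower_bound z hz
    rw [div_lt_iff₀ (by linarith)] at this
    rwa [lt_div_iff₀ hb0]
  · show z + (w / L z) • b ∈ Metric.ball 0 1
    rw [mem_ball_zero_iff]
    rw [lt_div_iff₀ hb0] at hw
    have h1 : ‖(w / (L z : ℂ)) • b‖ < 1 - ‖z‖ := by
      rw [norm_smul, norm_div, Complex.norm_real, Real.norm_eq_abs, abs_of_pos hLz, div_mul_eq_mul_div,
        div_lt_iff₀ hLz]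
      linarith
    linarith [norm_add_le z ((w / (L z : ℂ)) • b)]

lemma MemQ.div_mem_sliceDomain (hL : MemQ b β L) (hb : b ≠ 0)
    {z : EuclideanSpace ℂ (Fin n)} (hz : z ∈ unitBall n) {w : ℂ} (hw : ‖w‖ ≤ β) :
    w / L z ∈ sliceDomain b z := by
  obtain ⟨B, hB, h⟩ := hL.exists_lt_forall_mem_sliceDomain hb hz
  exact h w (hw.trans_lt hB)

lemma MemQ.exists_differentiableOn_rescaledSlice (hL : MemQ b β L) (hb : b ≠ 0)
    (hF : AnalyticOnNhd ℂ F (unitBall n)) {z : EuclideanSpace ℂ (Fin n)} (hz : z ∈ unitBall n) :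
    ∃ B, β < B ∧ DifferentiableOn ℂ (rescaledSlice b L F z) (Metric.ball 0 B) := by
  obtain ⟨B, hB, h⟩ := hL.exists_lt_forall_mem_sliceDomain hb hz
  refine ⟨B, hB, fun w hw => DifferentiableAt.differentiableWithinAt ?_⟩
  have h1 := (analyticAt_slice hF (h w (by simpa using hw))).differentiableAt
  exact DifferentiableAt.comp (f := fun w : ℂ => w / (L z : ℂ)) w h1 (by fun_prop)

/-- The case `η = β` of the condition on `λ₁` and `λ₂`, with both bounds merged into one constant.
-/
lemma MemQ.exists_comparison (hL : MemQ b β L) (hβ : 0 ≤ β) (hb : b ≠ 0) :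
    ∃ Λ : ℝ, 0 < Λ ∧ ∀ z ∈ unitBall n, ∀ w : ℂ, ‖w‖ ≤ β →
      L (z + (w / L z) • b) ≤ Λ * L z ∧ L z ≤ Λ * L (z + (w / L z) • b) := by
  obtain ⟨h1, -, h2⟩ := hL.lambda β ⟨hβ, le_rfl⟩
  -- Truncating at 1 excludes the value `⊤`, for which `toReal` would be 0.
  set lo := min (lambdaInf b L β) 1
  have hlo_pos : 0 < lo := lt_min h1 one_pos
  have hlo_top : lo ≠ ⊤ := ne_top_of_le_ne_top ENNReal.one_ne_top (min_le_right _ _)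
  have hlo' : 0 < lo.toReal := ENNReal.toReal_pos hlo_pos.ne' hlo_top
  refine ⟨max (lambdaSup b L β).toReal lo.toReal⁻¹, lt_max_of_lt_right (by positivity),
    fun z hz w hw => ?_⟩
  have hLz := hL.pos z hz
  have hLw : 0 < L (z + (w / L z) • b) := hL.pos _ (hL.div_mem_sliceDomain hb hz hw)
  have h0 : (0 : ℂ) ∈ sliceDomain b z := by simpa [sliceDomain] using hz
  have hmem : w / L z ∈ Metric.closedBall (0 : ℂ) (β / L (z + (0 : ℂ) • b)) := by
    rw [mem_closedBall_zero_iff, zero_smul, add_zero, norm_div, Complex.norm_real,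
      Real.norm_eq_abs, abs_of_pos hLz]
    gcongr
  have hz0 : z + (0 : ℂ) • b = z := by simp
  have hsup : ENNReal.ofReal (L (z + (w / L z) • b) / L z) ≤ lambdaSup b L β := by
    unfold lambdaSup
    refine le_iSup₂_of_le z hz (le_iSup₂_of_le 0 h0 (le_iSup₂_of_le _ hmem ?_))
    rw [hz0]
  have hinf : lambdaInf b L β ≤ ENNReal.ofReal (L (z + (w / L z) • b) / L z) := by
    unfold lambdaInf
    refine iInf₂_le_of_le z hz (iInf₂_le_of_le 0 h0 (iInf₂_le_of_le _ hmem ?_))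
    rw [hz0]
  constructor
  · rw [ENNReal.ofReal_le_iff_le_toReal h2.ne, div_le_iff₀ hLz] at hsup
    exact hsup.trans (by gcongr; exact le_max_left _ _)
  · have h3 : lo ≤ _ := (min_le_left _ _).trans hinf
    rw [ENNReal.le_ofReal_iff_toReal_le hlo_top (by positivity), le_div_iff₀ hLz] at h3
    calc L z = lo.toReal⁻¹ * (lo.toReal * L z) := by field_simp
      _ ≤ lo.toReal⁻¹ * L (z + (w / L z) • b) := by gcongr
      _ ≤ _ := by gcongr; exact le_max_right _ _

lemma analyticOrderAt_rescaledSlice (z₀ : EuclideanSpace ℂ (Fin n)) (t₀ : ℂ)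
    (hLz : L (z₀ + t₀ • b) ≠ 0) (w : ℂ) :
    analyticOrderAt (rescaledSlice b L F (z₀ + t₀ • b)) w =
      analyticOrderAt (fun t : ℂ => F (z₀ + t • b)) (t₀ + w / L (z₀ + t₀ • b)) := by
  set l := L (z₀ + t₀ • b) with hl
  have hd : HasDerivAt (fun w : ℂ => t₀ + w / (l : ℂ)) (1 / l) w := by
    simpa using ((hasDerivAt_id w).div_const (l : ℂ)).const_add t₀
  have h1 := analyticOrderAt_comp_of_deriv_ne_zero (f := fun t : ℂ => F (z₀ + t • b))
    (g := fun w : ℂ => t₀ + w / (l : ℂ)) (z₀ := w)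
    (by fun_prop (disch := exact_mod_cast hLz)) (by
      rw [hd.deriv]; exact one_div_ne_zero (by exact_mod_cast hLz))
  rw [← h1]
  congr 1
  ext w
  simp [rescaledSlice, add_smul, add_assoc, hl]

/-- Moving the base point along a complex line only translates the parameter and the zeros, so among
all base points `z₀` it suffices to consider `z` itself, at parameter 0. -/
lemma notMem_exceptionalSet_iff {z : EuclideanSpace ℂ (Fin n)} (hz : z ∈ unitBall n) {r : ℝ} :
    z ∉ exceptionalSet b L F r ↔ (∃ t ∈ sliceDomain b z, F (z + t • b) ≠ 0) ∧
      ∀ a ∈ sliceZeros b F z, r / L (z + a • b) < ‖a‖ := by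
  classical
  have hshift : ∀ (x : EuclideanSpace ℂ (Fin n)) (t u : ℂ),
      x + t • b + u • b = x + (t + u) • b := fun x t u => by rw [add_smul, add_assoc]
  constructor
  · intro h
    have h1 : z ∉ sliceExceptionalSet b L F r z := fun h2 =>
      h (Set.mem_biUnion hz h2)
    rw [sliceExceptionalSet] at h1
    split_ifs at h1 with h2
    · exact absurd ⟨0, by simpa [sliceDomain] using hz, by simp⟩ h1
    · push Not at h2
      refine ⟨h2, fun a ha => ?_⟩
      by_contra! hle
      exact h1 (Set.mem_biUnion ha ⟨0, by simpa using hle, by simp⟩)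
  · rintro ⟨⟨t, ht, hFt⟩, hzeros⟩ hmem
    obtain ⟨z₀, hz₀, h1⟩ := Set.mem_iUnion₂.mp hmem
    rw [sliceExceptionalSet] at h1
    split_ifs at h1 with h2
    · obtain ⟨u, -, rfl⟩ := h1
      simp only [sliceDomain, Set.mem_ofPred_eq, hshift] at ht hFt h2
      exact hFt (h2 _ ht)
    · obtain ⟨a, ha, u, hu, rfl⟩ := Set.mem_iUnion₂.mp h1
      have h3 := hzeros (a - u) (by
        simp only [sliceZeros, sliceDomain, Set.mem_ofPred_eq, hshift, add_sub_cancel] at ha ⊢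
        exact ha)
      simp only [hshift, add_sub_cancel] at h3
      rw [Metric.mem_closedBall, dist_comm, dist_eq_norm] at hu
      linarith

/-- Otherwise the slice function vanishes near 0, hence on the whole convex slice by the identity
theorem. -/
lemma exists_taylorNorm_pos (hF : AnalyticOnNhd ℂ F (unitBall n)) (hL : MemQ b β L) (hβ : 1 < β)
    (hb : b ≠ 0) {z : EuclideanSpace ℂ (Fin n)} (hz : z ∈ unitBall n)
    (hne : ∃ t ∈ sliceDomain b z, F (z + t • b) ≠ 0) :
    ∃ k, 0 < taylorNorm (rescaledSlice b L F z) k := by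
  by_contra! H
  obtain ⟨B, hB, hd⟩ := hL.exists_differentiableOn_rescaledSlice hb hF hz
  have hLz := hL.pos z hz
  have h0 : ∀ w : ℂ, ‖w‖ < 1 → rescaledSlice b L F z w = 0 := fun w hw => by
    have := norm_le_of_taylorNorm_le hd (by linarith) H hw
    rw [zero_mul] at this
    exact norm_le_zero_iff.mp this
  have hev : (fun t : ℂ => F (z + t • b)) =ᶠ[nhds 0] 0 := by
    filter_upwards [Metric.ball_mem_nhds (0 : ℂ) (show 0 < 1 / L z by positivity)] with t ht
    have := h0 (t * L z) (by
      rw [mem_ball_zero_iff, lt_div_iff₀ hLz] at ht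
      rwa [norm_mul, Complex.norm_real, Real.norm_eq_abs, abs_of_pos hLz])
    rwa [rescaledSlice, mul_div_cancel_right₀ _ (by exact_mod_cast hLz.ne')] at this
  obtain ⟨t, ht, hFt⟩ := hne
  have han : AnalyticOnNhd ℂ (fun t : ℂ => F (z + t • b)) (sliceDomain b z) :=
    fun t ht => analyticAt_slice hF ht
  exact hFt (han.eqOn_zero_of_preconnected_of_eventuallyEq_zero
    (convex_sliceDomain b z).isPreconnected (by simpa [sliceDomain] using hz) hev ht)

/-- The largest of the first `N + 1` coefficients serves all `m` at once. -/
lemma exists_dominating_taylorNorm {h : ℂ → ℂ} {N : ℕ}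
    (hN : ∀ m, ∃ k ≤ N, taylorNorm h m ≤ taylorNorm h k) :
    ∃ k₀ ≤ N, ∀ m, taylorNorm h m ≤ taylorNorm h k₀ := by
  obtain ⟨k₀, hk₀, hmax⟩ := Finset.exists_max_image (Finset.range (N + 1)) (taylorNorm h)
    Finset.nonempty_range_add_one
  simp only [Finset.mem_range, Nat.lt_succ_iff] at hk₀ hmax
  refine ⟨k₀, hk₀, fun m => ?_⟩
  obtain ⟨k, hk, hle⟩ := hN m
  exact hle.trans (hmax k hk)

/-! ### Bounded index implies both conditions. -/

/-- Bounded index bounds the logarithmic derivative off the exceptional set. -/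
lemma exists_logDeriv_bound (hF : AnalyticOnNhd ℂ F (unitBall n)) (hL : MemQ b β L) (hβ : 1 < β)
    (hb : b ≠ 0) {N : ℕ} (hN : ∀ z ∈ unitBall n, ∀ m, ∃ k ≤ N,
      taylorNorm (rescaledSlice b L F z) m ≤ taylorNorm (rescaledSlice b L F z) k)
    {r : ℝ} (hr : 0 < r) :
    ∃ P : ℝ, 0 < P ∧ ∀ z ∈ unitBall n \ exceptionalSet b L F r,
      ‖1 / F z * dirDeriv b F z‖ ≤ P * L z := by
  obtain ⟨Λ, hΛ, hcomp⟩ := hL.exists_comparison (by linarith) hb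
  -- For `z` outside the exceptional set, a zero `w` of the rescaled slice with `|w| ≤ β` satisfies
  -- `|w| > r L(z) / L(z + (w / L(z)) b) ≥ r / Λ`. The cap `1/2` is required by
  -- `taylorNorm_le_of_ne_zero`.
  set s := min (r / Λ) (1 / 2) with hs_def
  have hs : 0 < s := lt_min (by positivity) (by norm_num)
  have hsr : s ≤ r / Λ := min_le_left _ _
  have hs2 : s ≤ 1 / 2 := min_le_right _ _
  refine ⟨2 * (5 / s) ^ (2 * N), by positivity, fun z ⟨hz, hzG⟩ => ?_⟩
  obtain ⟨-, hzeros⟩ := (notMem_exceptionalSet_iff hz).mp hzG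
  have hLz := hL.pos z hz
  obtain ⟨B, hB, hd⟩ := hL.exists_differentiableOn_rescaledSlice hb hF hz
  obtain ⟨k₀, hk₀, hdom⟩ := exists_dominating_taylorNorm (hN z hz)
  have hne : ∀ w ∈ Metric.ball (0 : ℂ) s, rescaledSlice b L F z w ≠ 0 := fun w hw h0 => by
    rw [mem_ball_zero_iff] at hw
    have hwβ : ‖w‖ ≤ β := by linarith
    have h1 := hzeros (w / L z) ⟨hL.div_mem_sliceDomain hb hz hwβ, h0⟩
    have hLw : 0 < L (z + (w / L z) • b) := hL.pos _ (hL.div_mem_sliceDomain hb hz hwβ)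
    rw [norm_div, Complex.norm_real, Real.norm_eq_abs, abs_of_pos hLz, div_lt_div_iff₀ hLw hLz] at h1
    have h2 := (hcomp z hz w hwβ).1
    have h3 : ‖w‖ * Λ < r := by rw [← lt_div_iff₀ hΛ]; linarith
    nlinarith [norm_nonneg w]
  have h1 := taylorNorm_le_of_ne_zero hd (by linarith) hk₀ hdom hs hs2 hne
  have h2 := (hdom 1).trans h1
  have h00 : rescaledSlice b L F z 0 = F z := by simp [rescaledSlice]
  have hF0 : 0 < ‖F z‖ := norm_pos_iff.mpr (h00 ▸ hne 0 (Metric.mem_ball_self hs))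
  rw [taylorNorm_rescaledSlice hF hz hLz, h00, Nat.factorial_one, Nat.cast_one, one_mul, pow_one,
    div_le_iff₀ hLz] at h2
  rw [one_div, norm_mul, norm_inv, inv_mul_le_iff₀ hF0]
  calc ‖dirDeriv b F z‖ ≤ _ := h2
    _ = _ := by ring

/-- Bounded index bounds the number of zeros in small discs. -/
lemma exists_sum_order_le (hF : AnalyticOnNhd ℂ F (unitBall n)) (hL : MemQ b β L) (hβ : 1 < β)
    (hb : b ≠ 0) {N : ℕ} (hN : ∀ z ∈ unitBall n, ∀ m, ∃ k ≤ N,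
      taylorNorm (rescaledSlice b L F z) m ≤ taylorNorm (rescaledSlice b L F z) k) :
    ∃ q : ℕ, ∀ z₀ : EuclideanSpace ℂ (Fin n), (∃ t ∈ sliceDomain b z₀, F (z₀ + t • b) ≠ 0) →
      ∀ t₀ ∈ sliceDomain b z₀, ∀ s : Finset ℂ,
        (∀ a ∈ s, ‖a - t₀‖ ≤ 1 / (8 * L (z₀ + t₀ • b))) →
        ∑ a ∈ s, analyticOrderAt (fun t : ℂ => F (z₀ + t • b)) a ≤ (q : ℕ∞) := by
  classical
  obtain ⟨q, hq⟩ := exists_zeroBound N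
  refine ⟨q, fun z₀ hne t₀ ht₀ s hs => ?_⟩
  set z := z₀ + t₀ • b with hz_def
  have hz : z ∈ unitBall n := ht₀
  have hLz := hL.pos z hz
  have hLc : (L z : ℂ) ≠ 0 := by exact_mod_cast hLz.ne'
  obtain ⟨B, hB, hd⟩ := hL.exists_differentiableOn_rescaledSlice hb hF hz
  obtain ⟨k₀, hk₀, hdom⟩ := exists_dominating_taylorNorm (hN z hz)
  have hpos : 0 < taylorNorm (rescaledSlice b L F z) k₀ := by
    obtain ⟨t, ht, hFt⟩ := hne
    have hshift : z + (t - t₀) • b = z₀ + t • b := by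
      rw [hz_def, add_assoc, ← add_smul, add_sub_cancel]
    obtain ⟨k, hk⟩ := exists_taylorNorm_pos hF hL hβ hb hz
      ⟨t - t₀, by show z + (t - t₀) • b ∈ unitBall n; rw [hshift]; exact ht, by rwa [hshift]⟩
    exact hk.trans_le (hdom k)
  set o := analyticOrderAt (rescaledSlice b L F z) with ho
  have hord : ∀ a, analyticOrderAt (fun t : ℂ => F (z₀ + t • b)) a = o ((a - t₀) * L z) := by
    intro a
    rw [ho, hz_def, analyticOrderAt_rescaledSlice z₀ t₀ hLz.ne', ← hz_def,
      mul_div_cancel_right₀ _ hLc, add_sub_cancel]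
  have hinj : Set.InjOn (fun a : ℂ => (a - t₀) * L z) s := fun x _ y _ hxy => by
    simpa [hLc] using hxy
  have hsum : ∑ a ∈ s, analyticOrderAt (fun t : ℂ => F (z₀ + t • b)) a =
      ∑ w ∈ s.image (fun a : ℂ => (a - t₀) * L z), o w := by
    rw [Finset.sum_image hinj]
    exact Finset.sum_congr rfl fun a _ => hord a
  rw [hsum]
  set s' := s.image (fun a : ℂ => (a - t₀) * L z) with hs'_def
  have hs' : ∀ w ∈ s', ‖w‖ ≤ 1 / 8 := by
    intro w hw
    obtain ⟨a, ha, rfl⟩ := Finset.mem_image.mp hw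
    have := hs a ha
    rw [le_div_iff₀ (by positivity)] at this
    rw [norm_mul, Complex.norm_real, Real.norm_eq_abs, abs_of_pos hLz]
    linarith
  -- An order could be `⊤` a priori, so multiplicities are truncated at `q + 1`. Their sum turns out
  -- to be at most `q`, so no truncation took place.
  set mult : ℂ → ℕ := fun w => (min (o w) ((q + 1 : ℕ) : ℕ∞)).toNat with hmult
  have hcoe : ∀ w, (mult w : ℕ∞) = min (o w) ((q + 1 : ℕ) : ℕ∞) := fun w =>
    ENat.natCast_toNat (ne_top_of_le_ne_top (ENat.natCast_ne_top _) (min_le_right _ _))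
  have hle := hq _ (one_le_of_zeros_in_closedBall hd (by linarith) hk₀ hdom hpos s' mult hs'
    (fun w _ => by rw [hcoe]; exact min_le_left _ _))
  have heq : ∀ w ∈ s', o w = mult w := fun w hw => by
    have h1 : mult w ≤ q := (Finset.single_le_sum (fun _ _ => Nat.zero_le _) hw).trans hle
    rw [hcoe]
    refine (min_eq_left ?_).symm
    by_contra! hlt
    have h2 := hcoe w
    rw [min_eq_right hlt.le] at h2
    have : mult w = q + 1 := by exact_mod_cast h2
    omega
  rw [Finset.sum_congr rfl heq, ← Nat.cast_sum]
  exact_mod_cast hle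

/-- Bounded index bounds the number of zeros in discs of radius at most `β / L`. -/
lemma exists_zeroCount_le (hF : AnalyticOnNhd ℂ F (unitBall n)) (hL : MemQ b β L) (hβ : 1 < β)
    (hb : b ≠ 0) {N : ℕ} (hN : ∀ z ∈ unitBall n, ∀ m, ∃ k ≤ N,
      taylorNorm (rescaledSlice b L F z) m ≤ taylorNorm (rescaledSlice b L F z) k) :
    ∃ M : ℕ, ∀ r ≤ β, ∀ z₀ : EuclideanSpace ℂ (Fin n),
      (∃ t ∈ sliceDomain b z₀, F (z₀ + t • b) ≠ 0) → ∀ t₀ ∈ sliceDomain b z₀,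
        zeroCount b F (r / L (z₀ + t₀ • b)) z₀ t₀ ≤ (M : ℕ∞) := by
  classical
  obtain ⟨q, hq⟩ := exists_sum_order_le hF hL hβ hb hN
  obtain ⟨Λ, hΛ, hcomp⟩ := hL.exists_comparison (by linarith) hb
  -- Around a centre `τ`, a disc of rescaled radius `1 / (8Λ)` lies in the disc of radius `1 / (8L)`
  -- with `L` taken at the point of parameter `τ`, because `L` there is at most `Λ L(z)`. The number
  -- of discs depends only on `β` and `Λ`.
  obtain ⟨T, hTβ, hTfin, hTcover⟩ := (isCompact_closedBall (0 : ℂ) β).finite_cover_balls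
    (e := 1 / (8 * Λ)) (by positivity)
  lift T to Finset ℂ using hTfin
  refine ⟨T.card * q, fun r hr z₀ hne t₀ ht₀ => iSup₂_le fun s hs => ?_⟩
  set z := z₀ + t₀ • b with hz_def
  have hz : z ∈ unitBall n := ht₀
  have hLz := hL.pos z hz
  have hLc : (L z : ℂ) ≠ 0 := by exact_mod_cast hLz.ne'
  let part : ℂ → Finset ℂ := fun τ => s.filter (fun a => ‖(a - t₀) * L z - τ‖ ≤ 1 / (8 * Λ))
  have hsub : s ⊆ T.biUnion part := fun a ha => by
    have h1 := (hs ha).2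
    rw [Metric.mem_closedBall, dist_eq_norm, le_div_iff₀ hLz] at h1
    have h2 : (a - t₀) * L z ∈ Metric.closedBall (0 : ℂ) β := by
      rw [mem_closedBall_zero_iff, norm_mul, Complex.norm_real, Real.norm_eq_abs, abs_of_pos hLz]
      linarith
    obtain ⟨τ, hτ, h3⟩ := Set.mem_iUnion₂.mp (hTcover h2)
    rw [Metric.mem_ball, dist_eq_norm] at h3
    exact Finset.mem_biUnion.mpr ⟨τ, hτ, Finset.mem_filter.mpr ⟨ha, h3.le⟩⟩
  have hpart : ∀ τ ∈ T,
      ∑ a ∈ part τ, analyticOrderAt (fun t : ℂ => F (z₀ + t • b)) a ≤ (q : ℕ∞) := fun τ hτ => by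
    have hτβ : ‖τ‖ ≤ β := by simpa using hTβ hτ
    have hshift : z₀ + (t₀ + τ / L z) • b = z + (τ / L z) • b := by
      rw [add_smul, hz_def, add_assoc]
    have hmem : z + (τ / L z) • b ∈ unitBall n := hL.div_mem_sliceDomain hb hz hτβ
    have hLτ := hL.pos _ hmem
    refine hq z₀ hne (t₀ + τ / L z)
      (by show z₀ + (t₀ + τ / L z) • b ∈ unitBall n; rw [hshift]; exact hmem) _ fun a ha => ?_
    have h1 := (Finset.mem_filter.mp ha).2
    rw [hshift]
    have h2 : a - (t₀ + τ / L z) = ((a - t₀) * L z - τ) / L z := by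
      field_simp
      ring
    have h3 := (hcomp z hz τ hτβ).1
    rw [h2, norm_div, Complex.norm_real, Real.norm_eq_abs, abs_of_pos hLz, div_le_iff₀ hLz]
    refine h1.trans ?_
    rw [div_mul_eq_mul_div, one_mul, div_le_div_iff₀ (by positivity) (by positivity)]
    linarith
  calc ∑ a ∈ s, analyticOrderAt (fun t : ℂ => F (z₀ + t • b)) a
      ≤ ∑ a ∈ T.biUnion part, analyticOrderAt (fun t : ℂ => F (z₀ + t • b)) a :=
        Finset.sum_le_sum_of_subset hsub
    _ ≤ ∑ τ ∈ T, ∑ a ∈ part τ, analyticOrderAt (fun t : ℂ => F (z₀ + t • b)) a := by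
        clear hsub hpart hTcover hTβ
        induction T using Finset.induction_on with
        | empty => simp
        | insert τ T hτ ih =>
          rw [Finset.biUnion_insert, Finset.sum_insert hτ]
          refine le_trans ?_ (add_le_add_right ih _)
          rw [← Finset.sum_union_inter]
          exact le_self_add
    _ ≤ ∑ τ ∈ T, (q : ℕ∞) := Finset.sum_le_sum hpart
    _ = ((T.card * q : ℕ) : ℕ∞) := by simp

/-! ### Both conditions imply bounded index. -/

lemma sum_order_rescaledSlice_le {z : EuclideanSpace ℂ (Fin n)} (hL : MemQ b β L) (hb : b ≠ 0)
    (hz : z ∈ unitBall n) {q : ℕ∞} (hq : zeroCount b F (β / L (z + (0 : ℂ) • b)) z 0 ≤ q)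
    (s : Finset ℂ) (hs : ∀ w ∈ s, ‖w‖ ≤ β ∧ rescaledSlice b L F z w = 0) :
    ∑ w ∈ s, analyticOrderAt (rescaledSlice b L F z) w ≤ q := by
  classical
  have hLz := hL.pos z hz
  have hLc : (L z : ℂ) ≠ 0 := by exact_mod_cast hLz.ne'
  have hz0 : z + (0 : ℂ) • b = z := by simp
  have hord : ∀ w, analyticOrderAt (rescaledSlice b L F z) w =
      analyticOrderAt (fun t : ℂ => F (z + t • b)) (w / L z) := fun w => by
    have := analyticOrderAt_rescaledSlice (F := F) (b := b) (L := L) z 0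
      (by rw [hz0]; exact hLz.ne') w
    rwa [hz0, zero_add] at this
  have hinj : Set.InjOn (fun w : ℂ => w / L z) s := fun x _ y _ hxy => by
    simpa [hLc, div_left_inj'] using hxy
  refine le_trans ?_ hq
  unfold zeroCount
  refine le_iSup₂_of_le (s.image fun w : ℂ => w / L z) ?_ ?_
  · intro a ha
    obtain ⟨w, hw, rfl⟩ := Finset.mem_image.mp (Finset.mem_coe.mp ha)
    obtain ⟨h1, h2⟩ := hs w hw
    refine ⟨⟨hL.div_mem_sliceDomain hb hz h1, h2⟩, ?_⟩
    rw [hz0, mem_closedBall_zero_iff, norm_div, Complex.norm_real, Real.norm_eq_abs,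
      abs_of_pos hLz]
    gcongr
  · rw [Finset.sum_image hinj]
    exact (Finset.sum_congr rfl fun w _ => hord w).le

/-- A function with finitely many zeros in a closed disc, counted with multiplicity, is the product
of a polynomial and a function without zeros in the disc. -/
lemma exists_zero_free_factor {h : ℂ → ℂ} {B : ℝ} (hB : β < B)
    (hh : DifferentiableOn ℂ h (Metric.ball 0 B)) {q : ℕ}
    (hq : ∀ s : Finset ℂ, (∀ w ∈ s, ‖w‖ ≤ β ∧ h w = 0) →
      ∑ w ∈ s, analyticOrderAt h w ≤ (q : ℕ∞)) :
    ∃ (s : Finset ℂ) (m : ℂ → ℕ) (φ : ℂ → ℂ), (∀ w, w ∈ s ↔ ‖w‖ ≤ β ∧ h w = 0) ∧ s.card ≤ q ∧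
      ∑ a ∈ s, m a ≤ q ∧ DifferentiableOn ℂ φ (Metric.ball 0 B) ∧
      (∀ w, h w = (∏ a ∈ s, (w - a) ^ m a) * φ w) ∧ ∀ w, ‖w‖ ≤ β → φ w ≠ 0 := by
  have hball : ∀ w : ℂ, ‖w‖ ≤ β → w ∈ Metric.ball (0 : ℂ) B := fun w hw => by
    rw [mem_ball_zero_iff]; linarith
  have han : ∀ w : ℂ, ‖w‖ ≤ β → AnalyticAt ℂ h w := fun w hw =>
    hh.analyticAt (Metric.isOpen_ball.mem_nhds (hball w hw))
  -- Each zero has order at least 1, so the weighted count bounds the number of distinct zeros and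
  -- makes the zero set finite.
  have hcard : ∀ s : Finset ℂ, (∀ w ∈ s, ‖w‖ ≤ β ∧ h w = 0) → s.card ≤ q := fun s hs => by
    have h1 : ∑ w ∈ s, (1 : ℕ∞) ≤ ∑ w ∈ s, analyticOrderAt h w :=
      Finset.sum_le_sum fun w hw => Order.one_le_iff_pos.mpr (pos_iff_ne_zero.mpr
        (analyticOrderAt_ne_zero.mpr ⟨han w (hs w hw).1, (hs w hw).2⟩))
    have h2 := h1.trans (hq s hs)
    simp only [Finset.sum_const, nsmul_eq_mul, mul_one] at h2
    exact_mod_cast h2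
  have hfin : {w : ℂ | ‖w‖ ≤ β ∧ h w = 0}.Finite := by
    by_contra hinf
    obtain ⟨s, hs, hsc⟩ := Set.Infinite.exists_subset_card_eq hinf (q + 1)
    have := hcard s fun w hw => hs hw
    omega
  have hmem : ∀ w, w ∈ hfin.toFinset ↔ ‖w‖ ≤ β ∧ h w = 0 := fun w => by simp
  have hsum := hq hfin.toFinset fun w hw => (hmem w).mp hw
  have htop : ∀ a ∈ hfin.toFinset, analyticOrderAt h a ≠ ⊤ := fun a ha =>
    ne_top_of_le_ne_top (ENat.natCast_ne_top q)
      ((Finset.single_le_sum (fun _ _ => zero_le) ha).trans hsum)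
  have hcoe : ∀ a ∈ hfin.toFinset, ((analyticOrderAt h a).toNat : ℕ∞) = analyticOrderAt h a :=
    fun a ha => ENat.natCast_toNat (htop a ha)
  obtain ⟨φ, hφ, hφe⟩ := exists_eq_prod_sub_pow_mul Metric.isOpen_ball hh
    (fun a => (analyticOrderAt h a).toNat) hfin.toFinset
    (fun a ha => hball a ((hmem a).mp ha).1) (fun a ha => (hcoe a ha).le)
  refine ⟨hfin.toFinset, _, φ, hmem, hcard _ fun w hw => (hmem w).mp hw, ?_, hφ, hφe, ?_⟩
  · rw [← Finset.sum_congr rfl hcoe, ← Nat.cast_sum] at hsum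
    exact_mod_cast hsum
  · intro a ha hφa
    have has : a ∈ hfin.toFinset := (hmem a).mpr ⟨ha, by rw [hφe a, hφa, mul_zero]⟩
    have hφan : AnalyticAt ℂ φ a := hφ.analyticAt (Metric.isOpen_ball.mem_nhds (hball a ha))
    have hprod : AnalyticAt ℂ
        (fun w => ∏ a ∈ hfin.toFinset.erase a, (w - a) ^ (analyticOrderAt h a).toNat) a := by
      fun_prop
    have h1 : h = (fun w => (w - a) ^ (analyticOrderAt h a).toNat) *
        ((fun w => ∏ a ∈ hfin.toFinset.erase a, (w - a) ^ (analyticOrderAt h a).toNat) * φ) := by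
      ext w
      rw [hφe w, ← Finset.mul_prod_erase _ _ has]
      exact mul_assoc _ _ _
    -- The power of `w - a` already accounts for the full, finite order of `h` at `a`, so nothing is
    -- left for `φ`.
    have h2 : analyticOrderAt h a = analyticOrderAt h a +
        (analyticOrderAt (fun w => ∏ a ∈ hfin.toFinset.erase a,
          (w - a) ^ (analyticOrderAt h a).toNat) a + analyticOrderAt φ a) := by
      conv_lhs => rw [h1]
      rw [analyticOrderAt_mul (by fun_prop) (hprod.mul hφan), analyticOrderAt_mul hprod hφan,
        analyticOrderAt_sub_pow_self, hcoe a has]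
    have h3 := (ENat.add_le_add_iff_left (htop a has)).mp (h2.ge.trans (add_zero _).ge)
    exact analyticOrderAt_ne_zero.mpr ⟨hφan, hφa⟩ (add_eq_zero.mp (nonpos_iff_eq_zero.mp h3)).2

lemma deriv_rescaledSlice (hF : AnalyticOnNhd ℂ F (unitBall n)) {z : EuclideanSpace ℂ (Fin n)}
    {w : ℂ} (hw : w / L z ∈ sliceDomain b z) :
    deriv (rescaledSlice b L F z) w = dirDeriv b F (z + (w / L z) • b) / L z := by
  have h1 := (hF _ hw).differentiableAt.hasFDerivAt
  have h2 : HasDerivAt (fun w : ℂ => z + (w / (L z : ℂ)) • b) ((1 / (L z : ℂ)) • b) w :=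
    (((hasDerivAt_id w).div_const (L z : ℂ)).smul_const b).const_add z
  have h3 := h1.comp_hasDerivAt w h2
  have h4 : deriv (rescaledSlice b L F z) w =
      fderiv ℂ F (z + (w / L z) • b) ((1 / (L z : ℂ)) • b) := h3.deriv
  rw [h4, map_smul, dirDeriv, smul_eq_mul]
  ring

/-- The zero count is needed only at radius `β`, and the logarithmic derivative bound only at one
`r`, so small that points `δ`-far from the zeros of the rescaled slice lie outside the exceptional
set. -/
lemma exists_taylorNorm_le_of_logDeriv_of_zeroCount (hF : AnalyticOnNhd ℂ F (unitBall n))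
    (hL : MemQ b β L) (hβ : 1 < β) (hb : b ≠ 0)
    (hlog : ∀ r : ℝ, 0 < r → r ≤ β → ∃ P : ℝ, 0 < P ∧
      ∀ z ∈ unitBall n \ exceptionalSet b L F r, ‖1 / F z * dirDeriv b F z‖ ≤ P * L z)
    {q : ℕ} (hcount : ∀ z₀ ∈ unitBall n, (∃ t ∈ sliceDomain b z₀, F (z₀ + t • b) ≠ 0) →
      ∀ t₀ ∈ sliceDomain b z₀, zeroCount b F (β / L (z₀ + t₀ • b)) z₀ t₀ ≤ (q : ℕ∞)) :
    ∃ N : ℕ, ∀ z ∈ unitBall n, ∀ m, ∃ k ≤ N,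
      taylorNorm (rescaledSlice b L F z) m ≤ taylorNorm (rescaledSlice b L F z) k := by
  obtain ⟨Λ, hΛ, hcomp⟩ := hL.exists_comparison (by linarith) hb
  obtain ⟨δ, hδ, hindex⟩ := exists_taylorNorm_le_of_logDeriv_le hβ q
  set c := min δ ((β - 1) / 2)
  have hc : 0 < c := lt_min hδ (by linarith)
  have hcδ : c ≤ δ := min_le_left _ _
  have hcβ : c ≤ (β - 1) / 2 := min_le_right _ _
  set r := min β (c / (2 * Λ ^ 2))
  have hr : 0 < r := lt_min (by linarith) (by positivity)
  have hrβ : r ≤ β := min_le_left _ _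
  have hrΛ : r * Λ ^ 2 < c := by
    have : r ≤ c / (2 * Λ ^ 2) := min_le_right _ _
    rw [le_div_iff₀ (by positivity)] at this
    linarith
  obtain ⟨P, hP, hPle⟩ := hlog r hr hrβ
  obtain ⟨N, hN⟩ := hindex (P * Λ) (by positivity)
  refine ⟨N, fun z hz m => ?_⟩
  have hLz := hL.pos z hz
  have hLc : (L z : ℂ) ≠ 0 := by exact_mod_cast hLz.ne'
  obtain ⟨B, hB, hd⟩ := hL.exists_differentiableOn_rescaledSlice hb hF hz
  by_cases hne : ∃ t ∈ sliceDomain b z, F (z + t • b) ≠ 0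
  swap
  · push Not at hne
    refine ⟨0, Nat.zero_le _, le_trans ?_ (taylorNorm_nonneg _ _)⟩
    have := taylorNorm_le_div_pow (K := 0) hd one_pos (by linarith)
      (fun w hw => by
        rw [rescaledSlice, hne _ (hL.div_mem_sliceDomain hb hz (by linarith)), norm_zero]) m
    simpa using this
  have h0 : (0 : ℂ) ∈ sliceDomain b z := by simpa [sliceDomain] using hz
  obtain ⟨s, mult, φ, hs, hcard, hsum, hφ, hφe, hφne⟩ := exists_zero_free_factor hB hd
    (sum_order_rescaledSlice_le hL hb hz (hcount z hz hne 0 h0))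
  refine hN B _ φ s mult hB hd hφ hφe (fun a ha => ((hs a).mp ha).1) hcard hsum hφne
    (fun w hw hdist => ?_) m
  have hwβ : ‖w‖ ≤ β := by linarith
  set p := z + (w / L z) • b with hp_def
  have hp : p ∈ unitBall n := hL.div_mem_sliceDomain hb hz hwβ
  have hLp := hL.pos p hp
  obtain ⟨hpz, hzp⟩ := hcomp z hz w hwβ
  -- A zero of the slice through `p` violating this becomes the zero `w + a L(z)` of the rescaled
  -- slice at `z`, with `|a L(z)| ≤ r Λ² < c`; one factor `Λ` compares `z` with `p`, the other `p`
  -- with the zero. Then `c ≤ (β - 1) / 2` keeps it in the disc of radius `β`, hence in `s`, and `c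
  -- ≤ δ` contradicts `hdist`.
  have hzeros : ∀ a ∈ sliceZeros b F p, r / L (p + a • b) < ‖a‖ := by
    rintro a ⟨ha, hFa⟩
    by_contra! hle
    set x := p + a • b with hx_def
    have hx : x ∈ unitBall n := ha
    have hLx := hL.pos x hx
    have hLxc : (L x : ℂ) ≠ 0 := by exact_mod_cast hLx.ne'
    rw [le_div_iff₀ hLx] at hle
    -- The radius `r / L` is measured at the zero `x`, so the comparison is centred at `x` and the
    -- displacement leads back to `p`.
    have h1 := (hcomp x hx (-(a * L x)) (by
      rw [norm_neg, norm_mul, Complex.norm_real, Real.norm_eq_abs, abs_of_pos hLx]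
      linarith)).1
    rw [neg_div, mul_div_cancel_right₀ _ hLxc, hx_def, add_assoc, ← add_smul, add_neg_cancel,
      zero_smul, add_zero, ← hx_def] at h1
    have h2 : ‖a * L z‖ < c := by
      rw [norm_mul, Complex.norm_real, Real.norm_eq_abs, abs_of_pos hLz]
      calc ‖a‖ * L z ≤ ‖a‖ * (Λ * (Λ * L x)) := by
            gcongr
            exact hzp.trans (by gcongr)
        _ = ‖a‖ * L x * Λ ^ 2 := by ring
        _ ≤ r * Λ ^ 2 := by gcongr
        _ < c := hrΛ
    have h3 : w + a * L z ∈ s := (hs _).mpr ⟨by linarith [norm_add_le w (a * L z)], by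
      rw [rescaledSlice, add_div, mul_div_cancel_right₀ _ hLc, add_smul, ← add_assoc]
      exact hFa⟩
    have h4 := hdist _ h3
    rw [sub_add_cancel_left, norm_neg] at h4
    linarith
  have hnep : ∃ t ∈ sliceDomain b p, F (p + t • b) ≠ 0 := by
    obtain ⟨t, ht, hFt⟩ := hne
    have : p + (t - w / L z) • b = z + t • b := by
      rw [hp_def, add_assoc, ← add_smul, add_sub_cancel]
    exact ⟨t - w / L z, by show p + (t - w / L z) • b ∈ unitBall n; rw [this]; exact ht,
      by rwa [this]⟩
  have hFp : F p ≠ 0 := fun h => by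
    have := hzeros 0 ⟨by simpa [sliceDomain] using hp, by simpa using h⟩
    rw [norm_zero, zero_smul, add_zero] at this
    exact absurd this (by push Not; positivity)
  have h1 := hPle p ⟨hp, (notMem_exceptionalSet_iff hp).mpr ⟨hnep, hzeros⟩⟩
  have hFp' : 0 < ‖F p‖ := norm_pos_iff.mpr hFp
  rw [one_div, norm_mul, norm_inv, inv_mul_le_iff₀ hFp'] at h1
  rw [deriv_rescaledSlice hF hp, ← hp_def, norm_div, Complex.norm_real, Real.norm_eq_abs,
    abs_of_pos hLz, div_le_iff₀ hLz, show rescaledSlice b L F z w = F p from rfl]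
  calc ‖dirDeriv b F p‖ ≤ ‖F p‖ * (P * L p) := h1
    _ ≤ ‖F p‖ * (P * (Λ * L z)) := by gcongr
    _ = P * Λ * ‖F p‖ * L z := by ring

end Slices

theorem theorem12 {n : ℕ} (b : EuclideanSpace ℂ (Fin n)) (hb : b ≠ 0) (β : ℝ) (hβ : 1 < β)
    (L : EuclideanSpace ℂ (Fin n) → ℝ) (hL : MemQ b β L)
    (F : EuclideanSpace ℂ (Fin n) → ℂ) (hF : AnalyticOnNhd ℂ F (unitBall n))
    (hG : (unitBall n \ exceptionalSet b L F β).Nonempty) :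
    HasBoundedLIndexInDirection b L F ↔
      (∀ r : ℝ, 0 < r → r ≤ β → ∃ P : ℝ, 0 < P ∧
        ∀ z ∈ unitBall n \ exceptionalSet b L F r,
          ‖1 / F z * dirDeriv b F z‖ ≤ P * L z) ∧
      (∀ r : ℝ, 0 < r → r ≤ β → ∃ N : ℕ, ∀ z₀ ∈ unitBall n,
        (∃ t ∈ sliceDomain b z₀, F (z₀ + t • b) ≠ 0) →
        ∀ t₀ ∈ sliceDomain b z₀,
          zeroCount b F (r / L (z₀ + t₀ • b)) z₀ t₀ ≤ (N : ℕ∞)) := by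
  rw [hasBoundedLIndexInDirection_iff hF hL]
  constructor
  · rintro ⟨N, hN⟩
    obtain ⟨M, hM⟩ := exists_zeroCount_le hF hL hβ hb hN
    exact ⟨fun r hr _ => exists_logDeriv_bound hF hL hβ hb hN hr,
      fun r _ hrβ => ⟨M, fun z₀ _ => hM r hrβ z₀⟩⟩
  · rintro ⟨hlog, hcount⟩
    obtain ⟨q, hq⟩ := hcount β (by linarith) le_rfl
    exact exists_taylorNorm_le_of_logDeriv_of_zeroCount hF hL hβ hb hlog hq
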